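/- Let $M$ be an irreducible continuous-time Markov chain on a finite state set $V$ with transition rate matrix $Q=(q_{ij})$ such that $q_{ij}>0$ if and only if $q_{ji}>0$, and let $\bar\pi$ be its stationary distribution. Let $G$ be the simple graph on $V$ whose edges are the pairs $\{i,j\}$, $i\ne j$, with $q_{ij}>0$, and let $n=|E(G)|-|V|+1$ be its first Betti number. Choose a spanning tree of $G$, and enumerate and orient the remaining $n$ edges as $(a_k,b_k)$, $k=1,\dots,n$. Put $w(a_k,b_k)=\mathbf e_k$ and $w(b_k,a_k)=-\mathbf e_k$, where $\mathbf e_k$ is the $k$-th unit vector of $\mathbb Z^n$, and $w(i,j)=0$ for all other pairs. The lifted chain $L$ is the Markov chain on $V\times\mathbb Z^n$ that jumps from $(i,\alpha)$ to $(j,\alpha+w(i,j))$, $j\ne i$, with rate $q_{ij}$. Let $p(t)=(p_x(t))_{x\in V\times\mathbb Z^n}$ be the distribution of $L$ at time $t\ge 0$, and for $x=(i,\alpha)$, $y=(j,\beta)$ let $q_{xy}=q_{ij}$ if $i\neq j$ and $\beta=\alpha+w(i,j)$, and $q_{xy}=0$ for all other $x\ne y$. The entropy production rate of $L$ is $$e_p(t)=\frac12\sum_{x}\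 \sum_{y\ne x,\ q_{xy}>0}\big[p_x(t)q_{xy}-p_y(t)q_{yx}\big]\log\frac{p_x(t)q_{xy}}{p_y(t)q_{yx}},$$ and the stationary entropy production rate of $M$ is $$\bar e_p=\frac12\sum_{i}\ \sum_{j\ne i,\ q_{ij}>0}\big[\bar\pi_iq_{ij}-\bar\pi_jq_{ji}\big]\log\frac{\bar\pi_iq_{ij}}{\bar\pi_jq_{ji}}.$$ Assume that the initial distribution has finite entropy, $-\sum_x p_x(0)\log p_x(0)<\infty$. Then the series defining $e_p(t)$ converges for every $t>0$, $e_p$ is integrable on $[0,T]$ for every $T\ge 0$, and $$\lim_{T\to\infty}\frac1T\int_0^T e_p(t)\,\mathrm dt=\bar e_p .$$ -/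

import Mathlib

open Filter Topology MeasureTheory

/-! Continuous-time Markov chains given by their transition rates `r x y` (`x → y`),
with the usual convention `r x x = - ∑_{y ≠ x} r x y`. -/

/-- A transition rate matrix of a finite-state chain: non-negative off-diagonal
entries and rows that sum to zero. -/
structure IsRateMatrix {V : Type*} [Fintype V] (Q : Matrix V V ℝ) : Prop where
  nonneg : ∀ i j, i ≠ j → 0 ≤ Q i j
  row_sum : ∀ i, ∑ j, Q i j = 0

/-- Every state can be reached from every state through transitions of positive rate. -/
def IsIrreducibleChain {V : Type*} (Q : Matrix V V ℝ) : Prop :=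
  ∀ i j, Relation.ReflTransGen (fun a b => 0 < Q a b) i j

/-- A stationary probability distribution of a finite-state chain. -/
structure IsStationaryDistribution {V : Type*} [Fintype V] (Q : Matrix V V ℝ) (π : V → ℝ) :
    Prop where
  nonneg : ∀ i, 0 ≤ π i
  sum_one : ∑ i, π i = 1
  balance : ∀ j, ∑ i, π i * Q i j = 0

/-- `p t` (`t ≥ 0`) is the distribution at time `t` of a Markov chain with transition rates `r`:
a family of probability distributions solving the Kolmogorov forward (master) equation
`d p_x / dt = ∑_y p_y r_{yx}`. -/
structure IsChainLaw {S : Type*} (r : S → S → ℝ) (p : ℝ → S → ℝ) : Prop where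
  nonneg : ∀ t, 0 ≤ t → ∀ x, 0 ≤ p t x
  hasSum_one : ∀ t, 0 ≤ t → HasSum (p t) 1
  forward : ∀ t, 0 ≤ t → ∀ x,
    HasDerivWithinAt (fun s => p s x) (∑' y, p t y * r y x) (Set.Ici 0) t

/-- The contribution of the ordered pair `(x, y)` to (twice) the entropy production rate.
It vanishes when `x = y`, and when `x` and `y` are not adjacent (both rates are `0`). -/
noncomputable def entropyProductionTerm {S : Type*} (r : S → S → ℝ) (p : S → ℝ) (z : S × S) : ℝ :=
  (p z.1 * r z.1 z.2 - p z.2 * r z.2 z.1) *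
    Real.log ((p z.1 * r z.1 z.2) / (p z.2 * r z.2 z.1))

/-- The entropy production rate of a chain with rates `r` in the distribution `p`. -/
noncomputable def entropyProductionRate {S : Type*} (r : S → S → ℝ) (p : S → ℝ) : ℝ :=
  (1 / 2) * ∑' z : S × S, entropyProductionTerm r p z

/-- The distribution `p` has finite entropy `∑ -p_x log p_x`
(all terms are non-negative for a probability distribution). -/
def HasFiniteEntropy {S : Type*} (p : S → ℝ) : Prop :=
  Summable (fun x => Real.negMulLog (p x))

/-! The lattice lift. -/

/-- The graph of a chain: vertices are the states, edges are the possible transitions. -/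
def transitionGraph {V : Type*} (Q : Matrix V V ℝ) : SimpleGraph V :=
  SimpleGraph.fromRel (fun i j => 0 < Q i j)

/-- The first Betti number `|E| - |V| + 1` of a connected finite graph. -/
noncomputable def firstBettiNumber {V : Type*} (G : SimpleGraph V) : ℤ :=
  (G.edgeSet.ncard : ℤ) - (Nat.card V : ℤ) + 1

/-- The data that define the lift: a spanning tree of the graph of the chain, and
an enumeration, with an orientation from `tail k` to `head k`, of the special edges
(the edges outside the tree). The `k`-th special edge crosses the `k`-th pair of opposite faces
of the unit cube once. -/
structure TorusEmbedding {V : Type*} (Q : Matrix V V ℝ) (n : ℕ) where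
  tree : SimpleGraph V
  tree_le : tree ≤ transitionGraph Q
  isTree : tree.IsTree
  tail : Fin n → V
  head : Fin n → V
  special : Set.BijOn (fun k => s(tail k, head k)) Set.univ
    ((transitionGraph Q).edgeSet \ tree.edgeSet)

/-- The number of special edges is the first Betti number. -/
theorem TorusEmbedding.betti {V : Type*} [Fintype V] {Q : Matrix V V ℝ} {n : ℕ}
    (e : TorusEmbedding Q n) : (n : ℤ) = firstBettiNumber (transitionGraph Q) := by
  classical
  have h1 : ((transitionGraph Q).edgeSet \ e.tree.edgeSet).ncard = n := by
    rw [← e.special.image_eq, Set.InjOn.ncard_image e.special.injOn]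
    simp [Set.ncard_univ]
  have hsub : e.tree.edgeSet ⊆ (transitionGraph Q).edgeSet :=
    SimpleGraph.edgeSet_mono e.tree_le
  have h2 := Set.ncard_sdiff_add_ncard_of_subset hsub (Set.toFinite _)
  have h3 := e.isTree.card_edgeFinset
  have h4 : e.tree.edgeSet.ncard = e.tree.edgeFinset.card := by
    rw [← SimpleGraph.coe_edgeFinset, Set.ncard_coe_finset]
  unfold firstBettiNumber
  rw [Nat.card_eq_fintype_card]
  omega

/-- The change of the `ℤⁿ`-coordinate when the chain jumps from `i` to `j`. -/
def TorusEmbedding.crossing {V : Type*} [DecidableEq V] {Q : Matrix V V ℝ} {n : ℕ}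
    (e : TorusEmbedding Q n) (i j : V) : Fin n → ℤ := fun k =>
  if i = e.tail k ∧ j = e.head k then 1
  else if i = e.head k ∧ j = e.tail k then -1
  else 0

/-- The transition rates of the lifted chain on `V × ℤⁿ`: from `(i, α)` it jumps
to `(j, α + crossing i j)` with rate `Q i j`. -/
def TorusEmbedding.liftRate {V : Type*} [DecidableEq V] {Q : Matrix V V ℝ} {n : ℕ}
    (e : TorusEmbedding Q n) (x y : V × (Fin n → ℤ)) : ℝ :=
  if y.2 = x.2 + e.crossing x.1 y.1 then Q x.1 y.1 else 0

/-! ### Summation over the lifted state space `V × A` -/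

section Lift

variable {V A : Type*}

/-! The proof rests on the entropy balance `e_p = dH/dt + F` (`IsLiftLaw.entropy_balance`). Here `H`
is the entropy of the lifted law, and the entropy flux `F = ∑ i, (∑ j, Q i j * log (Q i j / Q j i))
* P i` sees the lift only through its marginals `P` on `V`. After integrating and dividing by `T`,
two limits remain.

The flux: the marginals solve the master equation of `M`, so their time averages are stationary up
to `O(1 / T)` and converge to `π` (`IsLiftLaw.tendsto_average_marginal`). At stationarity the flux
is all of the production (`IsStationaryDistribution.entropyProductionRate_eq`).

The entropy: `H T = o(T)`. By Gibbs' inequality `H` is at most the mean of `-log g` plus a constant,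
for any positive summable `g` on the lattice. If `log g` changes by at most `δ` per jump, this mean
grows with slope at most `C * δ` (`IsLiftLaw.entropy_le`). On `ℤⁿ`, `exp (-ε |α|₁)` is summable for
every `ε > 0`, so `δ` can be arbitrarily small (`exists_lattice_weight`). Smoothing the initial law
by such a weight gives a `g` that dominates it, so finite initial entropy suffices and no moments
are needed.

The analytic difficulty is to differentiate the infinite entropy series termwise, which needs
control of `-log p` at a neighbouring state. The uniformization series yields a Harnack inequality
(`IsLiftLaw.harnack`). It bounds the cross entropies by `H + c * t + |log (Q i j * t)|`, which is
integrable down to `t = 0`. -/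

/-- The law of a chain on `V × A` that jumps from `(i, α)` to `(j, α + w i j)` with rate `Q i j`:
the forward equation is written as a finite sum over the possible preceding states. -/
structure IsLiftLaw [Fintype V] [AddCommGroup A] (Q : Matrix V V ℝ) (w : V → V → A)
    (p : ℝ → V × A → ℝ) : Prop where
  nonneg : ∀ t, 0 ≤ t → ∀ x, 0 ≤ p t x
  hasSum_one : ∀ t, 0 ≤ t → HasSum (p t) 1
  forward : ∀ t, 0 ≤ t → ∀ j β,
    HasDerivWithinAt (fun s => p s (j, β)) (∑ i, p t (i, β - w i j) * Q i j) (Set.Ici 0) t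

theorem HasSum.congr_terms {ι : Type*} {f g : ι → ℝ} {a : ℝ} (h : HasSum f a)
    (hfg : ∀ i, f i = g i) : HasSum g a :=
  funext hfg ▸ h

/-- The sum over a product with a finite first factor can be computed slice by slice. -/
theorem hasSum_prod_of_fintype [Fintype V] {f : V × A → ℝ} {a : V → ℝ}
    (h : ∀ i, HasSum (fun α => f (i, α)) (a i)) : HasSum f (∑ i, a i) := by
  classical
  have h1 : ∀ i, HasSum (fun x : V × A => if x.1 = i then f x else 0) (a i) := by
    intro i
    have hinj : Function.Injective (fun α : A => (i, α)) := fun a b hab => by simpa using hab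
    rw [← hinj.hasSum_iff]
    · simpa [Function.comp_def] using h i
    · rintro ⟨j, β⟩ hx
      have : j ≠ i := by
        rintro rfl
        exact hx ⟨β, rfl⟩
      simp [this]
  have h2 := hasSum_sum (s := Finset.univ) (fun i _ => h1 i)
  simpa using h2

theorem Summable.slice {f : V × A → ℝ} (h : Summable f) (i : V) :
    Summable (fun α => f (i, α)) :=
  h.comp_injective (i := fun α : A => (i, α)) (fun a b hab => by simpa using hab)

theorem hasSum_slices [Fintype V] {f : V × A → ℝ} (h : Summable f) :
    HasSum f (∑ i, ∑' α, f (i, α)) :=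
  hasSum_prod_of_fintype fun i => (h.slice i).hasSum

theorem tsum_slices [Fintype V] {f : V × A → ℝ} (h : Summable f) :
    ∑' x, f x = ∑ i, ∑' α, f (i, α) := (hasSum_slices h).tsum_eq

end Lift

/-! ### Antisymmetry of the crossings and the finite forward equation -/

section Crossing

variable {V : Type*} {Q : Matrix V V ℝ} {n : ℕ}

theorem TorusEmbedding.tail_ne_head (e : TorusEmbedding Q n) (k : Fin n) :
    e.tail k ≠ e.head k := by
  have h := (e.special.mapsTo (Set.mem_univ k)).1
  rw [SimpleGraph.mem_edgeSet] at h
  exact h.ne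

/-- Makes a reverse jump return to the original lattice copy, and forces the diagonal crossings to
vanish. -/
theorem TorusEmbedding.crossing_swap [DecidableEq V] (e : TorusEmbedding Q n) (i j : V) :
    e.crossing j i = -e.crossing i j := by
  funext k
  have h := e.tail_ne_head k
  simp only [TorusEmbedding.crossing, Pi.neg_apply]
  by_cases h1 : i = e.tail k ∧ j = e.head k
  · have h2 : ¬ (j = e.tail k ∧ i = e.head k) := fun h2 => h (h1.1 ▸ h2.2)
    have h3 : j = e.head k ∧ i = e.tail k := ⟨h1.2, h1.1⟩
    rw [if_pos h1, if_neg h2, if_pos h3]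
  · by_cases h4 : i = e.head k ∧ j = e.tail k
    · have h5 : j = e.tail k ∧ i = e.head k := ⟨h4.2, h4.1⟩
      rw [if_neg h1, if_pos h4, if_pos h5]
      simp
    · have h5 : ¬ (j = e.tail k ∧ i = e.head k) := fun h => h4 ⟨h.2, h.1⟩
      have h6 : ¬ (j = e.head k ∧ i = e.tail k) := fun h => h1 ⟨h.2, h.1⟩
      rw [if_neg h1, if_neg h4, if_neg h5, if_neg h6]
      simp

/-- For each preceding vertex `i`, only the copy `β - crossing i j` has a non-zero rate into `(j,
β)`, so the infinite sum collapses to one over `V`. -/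
theorem IsChainLaw.isLiftLaw [Fintype V] [DecidableEq V] {e : TorusEmbedding Q n}
    {p : ℝ → V × (Fin n → ℤ) → ℝ} (hp : IsChainLaw e.liftRate p) :
    IsLiftLaw Q e.crossing p where
  nonneg := hp.nonneg
  hasSum_one := hp.hasSum_one
  forward := by
    intro t ht j β
    have h := hp.forward t ht (j, β)
    have h2 : ∑' y, p t y * e.liftRate y (j, β) = ∑ i, p t (i, β - e.crossing i j) * Q i j := by
      refine (hasSum_prod_of_fintype fun i => ?_).tsum_eq
      have := hasSum_single (f := fun α => p t (i, α) * e.liftRate (i, α) (j, β))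
        (β - e.crossing i j) (by
          intro α hα
          have : ¬ (β = α + e.crossing i j) := fun h => hα (by rw [h]; abel)
          simp [TorusEmbedding.liftRate, this])
      simpa [TorusEmbedding.liftRate] using this
    rwa [h2] at h

end Crossing

/-! ### Uniformization series and a Harnack inequality -/

section Uniformization

/-- The jump rates of the uniformized chain: `c` is added on the diagonal. -/
def uniformized {V : Type*} [DecidableEq V] (Q : Matrix V V ℝ) (c : ℝ) : Matrix V V ℝ :=
  Q + c • (1 : Matrix V V ℝ)

theorem uniformized_of_ne {V : Type*} [DecidableEq V] {Q : Matrix V V ℝ} (c : ℝ)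
    {i j : V} (h : i ≠ j) :
    uniformized Q c i j = Q i j := by
  simp [uniformized, h]

variable {V A : Type*} [Fintype V] [AddCommGroup A]

/-- The measure `u` on `V × A` after one jump with the (unnormalized) jump kernel
`(i, α) → (j, α + w i j)` of weight `B i j`. -/
def jumpStep (B : Matrix V V ℝ) (w : V → V → A) (u : V × A → ℝ) (x : V × A) : ℝ :=
  ∑ i, u (i, x.2 - w i x.1) * B i x.1

theorem jumpStep_nonneg {B : Matrix V V ℝ} {w : V → V → A} {u : V × A → ℝ}
    (hB : ∀ i j, 0 ≤ B i j) (hu : ∀ x, 0 ≤ u x) (x : V × A) : 0 ≤ jumpStep B w u x :=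
  Finset.sum_nonneg fun _ _ => mul_nonneg (hu _) (hB _ _)

theorem hasSum_jumpStep {B : Matrix V V ℝ} {w : V → V → A} {u : V × A → ℝ} (hu : Summable u) :
    HasSum (jumpStep B w u) (∑ j, ∑ i, (∑' α, u (i, α)) * B i j) := by
  refine hasSum_prod_of_fintype fun j => hasSum_sum fun i _ => HasSum.mul_right _ ?_
  exact (Equiv.subRight (w i j)).hasSum_iff.mpr (hu.slice i).hasSum

theorem hasSum_jumpStep_of_row_sum {B : Matrix V V ℝ} {w : V → V → A} {u : V × A → ℝ} {c s : ℝ}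
    (hB : ∀ i, ∑ j, B i j = c) (hu : HasSum u s) : HasSum (jumpStep B w u) (s * c) := by
  have h := hasSum_jumpStep (B := B) (w := w) hu.summable
  rw [Finset.sum_comm] at h
  simp_rw [← Finset.mul_sum, hB, ← Finset.sum_mul] at h
  rwa [← tsum_slices hu.summable, hu.tsum_eq] at h

theorem le_jumpStep {B : Matrix V V ℝ} {w : V → V → A} {u : V × A → ℝ}
    (hB : ∀ i j, 0 ≤ B i j) (hu : ∀ x, 0 ≤ u x) (i j : V) (α : A) :
    u (i, α) * B i j ≤ jumpStep B w u (j, α + w i j) := by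
  have h := Finset.single_le_sum (s := Finset.univ)
    (f := fun k => u (k, α + w i j - w k j) * B k j)
    (fun k _ => mul_nonneg (hu _) (hB _ _)) (Finset.mem_univ i)
  simpa [jumpStep] using h

variable {Q : Matrix V V ℝ} {w : V → V → A} {p : ℝ → V × A → ℝ} {c : ℝ}

theorem IsLiftLaw.hasDerivWithinAt (hp : IsLiftLaw Q w p) {t : ℝ} (ht : 0 ≤ t) (x : V × A) :
    HasDerivWithinAt (fun s => p s x) (jumpStep Q w (p t) x) (Set.Ici 0) t :=
  hp.forward t ht x.1 x.2

theorem IsLiftLaw.hasDerivAt (hp : IsLiftLaw Q w p) {t : ℝ} (ht : 0 < t) (x : V × A) :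
    HasDerivAt (fun s => p s x) (jumpStep Q w (p t) x) t :=
  (hp.hasDerivWithinAt ht.le x).hasDerivAt (Ici_mem_nhds ht)

theorem IsLiftLaw.continuousOn (hp : IsLiftLaw Q w p) (x : V × A) :
    ContinuousOn (fun s => p s x) (Set.Ici 0) :=
  fun _ ht => (hp.hasDerivWithinAt ht x).continuousWithinAt

theorem iterate_jumpStep_nonneg {B : Matrix V V ℝ} {u : V × A → ℝ}
    (hB : ∀ i j, 0 ≤ B i j) (hu : ∀ x, 0 ≤ u x) (m : ℕ) (x : V × A) :
    0 ≤ (jumpStep B w)^[m] u x := by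
  induction m generalizing x with
  | zero => exact hu x
  | succ m ih =>
    rw [Function.iterate_succ_apply']
    exact jumpStep_nonneg hB ih x

variable [DecidableEq V]

theorem jumpStep_uniformized {Q : Matrix V V ℝ} {w : V → V → A} (hw : ∀ i, w i i = 0) (c : ℝ)
    (u : V × A → ℝ) (x : V × A) :
    jumpStep (uniformized Q c) w u x = jumpStep Q w u x + c * u x := by
  simp only [jumpStep, uniformized, Matrix.add_apply, Matrix.smul_apply, Matrix.one_apply,
    mul_add, Finset.sum_add_distrib, smul_eq_mul, mul_ite, mul_one, mul_zero]
  simp [hw, mul_comm]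

theorem uniformized_row_sum {Q : Matrix V V ℝ} (hQ : IsRateMatrix Q) (c : ℝ) (i : V) :
    ∑ j, uniformized Q c i j = c := by
  simp [uniformized, Matrix.one_apply, Finset.sum_add_distrib, hQ.row_sum]

theorem IsRateMatrix.exists_uniformized_nonneg {Q : Matrix V V ℝ} (hQ : IsRateMatrix Q) :
    ∃ c, 0 ≤ c ∧ ∀ i j, 0 ≤ uniformized Q c i j := by
  refine ⟨∑ i, |Q i i|, Finset.sum_nonneg fun _ _ => abs_nonneg _, fun i j => ?_⟩
  by_cases h : i = j
  · subst h
    have h1 := Finset.single_le_sum (s := Finset.univ) (f := fun i => |Q i i|)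
      (fun _ _ => abs_nonneg _) (Finset.mem_univ i)
    have h2 := neg_abs_le (Q i i)
    simp only [uniformized, Matrix.add_apply, Matrix.smul_apply, Matrix.one_apply_eq, smul_eq_mul,
      mul_one]
    linarith
  · rw [uniformized_of_ne _ h]
    exact hQ.nonneg i j h

/-- Every partial sum of the uniformization series is bounded by the law. -/
theorem IsLiftLaw.sum_uniformization_le (hp : IsLiftLaw Q w p) (hw : ∀ i, w i i = 0)
    (hB : ∀ i j, 0 ≤ uniformized Q c i j) (M : ℕ) {t : ℝ} (ht : 0 ≤ t) (x : V × A) :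
    ∑ m ∈ Finset.range M, t ^ m / m.factorial * (jumpStep (uniformized Q c) w)^[m] (p 0) x ≤
      Real.exp (c * t) * p t x := by
  induction M generalizing t x with
  | zero => simpa using mul_nonneg (Real.exp_pos _).le (hp.nonneg t ht x)
  | succ M ih =>
    set a : ℕ → V × A → ℝ := fun m => (jumpStep (uniformized Q c) w)^[m] (p 0) with ha
    have hstep : ∀ m x, a (m + 1) x = jumpStep (uniformized Q c) w (a m) x := by
      intro m x
      simp only [ha, Function.iterate_succ_apply']
    -- The derivative of this remainder is one jump step, with non-negative weights, of the
    -- remainder that has one term fewer. By induction it is non-negative, and `d 0 = 0`.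
    let d : ℝ → ℝ := fun s =>
      Real.exp (c * s) * p s x - ∑ m ∈ Finset.range (M + 1), s ^ m / m.factorial * a m x
    have hexp : ∀ s, HasDerivAt (fun s => Real.exp (c * s)) (Real.exp (c * s) * c) s := by
      intro s
      simpa using ((hasDerivAt_id s).const_mul c).exp
    have hpow : ∀ s, HasDerivAt
        (fun s => ∑ m ∈ Finset.range (M + 1), s ^ m / m.factorial * a m x)
        (∑ m ∈ Finset.range M, s ^ m / m.factorial * a (m + 1) x) s := by
      intro s
      have h := HasDerivAt.fun_sum (u := Finset.range (M + 1))
        (A := fun m s => s ^ m / (m.factorial : ℝ) * a m x)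
        (A' := fun m => (m * s ^ (m - 1)) / (m.factorial : ℝ) * a m x) (x := s)
        (fun m _ => ((hasDerivAt_pow m s).div_const _).mul_const _)
      rw [Finset.sum_range_succ'] at h
      simp only [Nat.cast_zero, zero_mul, zero_div, add_zero] at h
      refine h.congr_deriv (Finset.sum_congr rfl fun m _ => ?_)
      rw [Nat.factorial_succ]
      push_cast
      have : (m.factorial : ℝ) ≠ 0 := by positivity
      field_simp
    let d' : ℝ → ℝ := fun s => (Real.exp (c * s) * c) * p s x +
        Real.exp (c * s) * jumpStep Q w (p s) x -
        ∑ m ∈ Finset.range M, s ^ m / m.factorial * a (m + 1) x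
    have hd : ∀ s, 0 ≤ s → HasDerivWithinAt d (d' s) (Set.Ici 0) s := fun s hs =>
      ((hexp s).hasDerivWithinAt.mul (hp.hasDerivWithinAt hs x)).sub (hpow s).hasDerivWithinAt
    have hd' : ∀ s, 0 ≤ s → 0 ≤ d' s := by
      intro s hs
      have h1 : d' s = jumpStep (uniformized Q c) w (fun y => Real.exp (c * s) * p s y -
          ∑ m ∈ Finset.range M, s ^ m / m.factorial * a m y) x := by
        have h2 : jumpStep (uniformized Q c) w (fun y => Real.exp (c * s) * p s y -
            ∑ m ∈ Finset.range M, s ^ m / m.factorial * a m y) x =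
            Real.exp (c * s) * jumpStep (uniformized Q c) w (p s) x -
            ∑ m ∈ Finset.range M, s ^ m / m.factorial * jumpStep (uniformized Q c) w (a m) x := by
          simp only [jumpStep, sub_mul, Finset.sum_sub_distrib, Finset.mul_sum, Finset.sum_mul]
          congr 1
          · exact Finset.sum_congr rfl fun _ _ => by ring
          · rw [Finset.sum_comm]
            exact Finset.sum_congr rfl fun _ _ => Finset.sum_congr rfl fun _ _ => by ring
        rw [h2, jumpStep_uniformized hw]
        simp only [d', hstep]
        ring
      rw [h1]
      exact jumpStep_nonneg hB (fun y => sub_nonneg.mpr (ih hs y)) x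
    have hmono : MonotoneOn d (Set.Ici 0) := by
      refine monotoneOn_of_hasDerivWithinAt_nonneg (convex_Ici 0)
        (fun s hs => (hd s hs).continuousWithinAt) (f' := d') ?_ ?_
      · intro s hs
        rw [interior_Ici] at hs ⊢
        exact (hd s (le_of_lt hs)).mono Set.Ioi_subset_Ici_self
      · intro s hs
        rw [interior_Ici] at hs
        exact hd' s (le_of_lt hs)
    have h0 : d 0 = 0 := by
      simp [d, Finset.sum_range_succ', a]
    have := hmono Set.self_mem_Ici ht ht
    rw [h0] at this
    exact sub_nonneg.mp this

/-- The uniformization series of the law of the lifted chain. -/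
theorem IsLiftLaw.hasSum_uniformization (hp : IsLiftLaw Q w p) (hQ : IsRateMatrix Q)
    (hw : ∀ i, w i i = 0) (hB : ∀ i j, 0 ≤ uniformized Q c i j) {t : ℝ} (ht : 0 ≤ t) (x : V × A) :
    HasSum (fun m : ℕ => t ^ m / m.factorial * (jumpStep (uniformized Q c) w)^[m] (p 0) x)
      (Real.exp (c * t) * p t x) := by
  set f : ℕ → V × A → ℝ :=
    fun m x => t ^ m / m.factorial * (jumpStep (uniformized Q c) w)^[m] (p 0) x with hf
  have hf0 : ∀ m x, 0 ≤ f m x := fun m x =>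
    mul_nonneg (by positivity) (iterate_jumpStep_nonneg hB (hp.nonneg 0 le_rfl) m x)
  have hsum : ∀ x, Summable (fun m => f m x) := fun x =>
    summable_of_sum_range_le (fun m => hf0 m x)
      (fun M => hp.sum_uniformization_le hw hB M ht x)
  have hle : ∀ x, ∑' m, f m x ≤ Real.exp (c * t) * p t x := fun x =>
    Real.tsum_le_of_sum_range_le (fun m => hf0 m x)
      (fun M => hp.sum_uniformization_le hw hB M ht x)
  have hmass : ∀ m, HasSum (f m) (t ^ m / m.factorial * c ^ m) := by
    intro m
    refine HasSum.mul_left _ ?_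
    induction m with
    | zero => simpa using hp.hasSum_one 0 le_rfl
    | succ m ih =>
      rw [Function.iterate_succ_apply', pow_succ]
      exact hasSum_jumpStep_of_row_sum (uniformized_row_sum hQ c) ih
  have hexp : HasSum (fun m : ℕ => t ^ m / m.factorial * c ^ m) (Real.exp (c * t)) := by
    have h := NormedSpace.expSeries_div_hasSum_exp (𝔸 := ℝ) (c * t)
    rw [← Real.exp_eq_exp_ℝ] at h
    refine h.congr_terms fun m => ?_
    rw [mul_pow]
    ring
  have hprod : Summable (fun z : ℕ × (V × A) => f z.1 z.2) := by
    rw [summable_prod_of_nonneg (fun z => hf0 z.1 z.2)]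
    refine ⟨fun m => (hmass m).summable, ?_⟩
    simp_rw [fun m => (hmass m).tsum_eq]
    exact hexp.summable
  have h1 : HasSum (fun z : ℕ × (V × A) => f z.1 z.2) (Real.exp (c * t)) := by
    have := hprod.hasSum.prod_fiberwise (fun m => hmass m)
    rw [← this.unique hexp]
    exact hprod.hasSum
  have h2 : HasSum (fun x => ∑' m, f m x) (Real.exp (c * t)) :=
    ((Equiv.prodComm (V × A) ℕ).hasSum_iff.mpr h1).prod_fiberwise (fun x => (hsum x).hasSum)
  -- Law and series have the same total mass `exp (c * t)`, so the pointwise inequality `hle` must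
  -- be an equality at every state.
  have h3 := ((hp.hasSum_one t ht).mul_left (Real.exp (c * t))).sub h2
  rw [mul_one, sub_self] at h3
  have h4 := (hasSum_zero_iff_of_nonneg (fun x => sub_nonneg.mpr (hle x))).mp h3
  have h5 : Real.exp (c * t) * p t x = ∑' m, f m x := sub_eq_zero.mp (congrFun h4 x)
  rw [h5]
  exact (hsum x).hasSum

/-- A state that has probability zero at some positive time has probability zero at all times. -/
theorem IsLiftLaw.eq_zero_of_eq_zero (hp : IsLiftLaw Q w p) (hQ : IsRateMatrix Q)
    (hw : ∀ i, w i i = 0) {s t : ℝ} (hs : 0 < s) (ht : 0 ≤ t) {x : V × A} (h : p s x = 0) :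
    p t x = 0 := by
  obtain ⟨c, -, hB⟩ := hQ.exists_uniformized_nonneg
  have h1 := hp.hasSum_uniformization hQ hw hB hs.le x
  rw [h, mul_zero, hasSum_zero_iff_of_nonneg] at h1
  · have h2 := hp.hasSum_uniformization hQ hw hB ht x
    -- The coefficients of the series do not depend on time; being non-negative, they all vanish
    -- once the sum does at one positive time.
    have h3 : ∀ m, (jumpStep (uniformized Q c) w)^[m] (p 0) x = 0 := by
      intro m
      have := congrFun h1 m
      simp only [Pi.zero_apply, mul_eq_zero] at this
      rcases this with h | h
      · have : 0 < s ^ m / m.factorial := by positivity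
        linarith
      · exact h
    simp only [h3, mul_zero] at h2
    have := h2.unique hasSum_zero
    simpa [(Real.exp_pos _).ne'] using this
  · intro m
    exact mul_nonneg (by positivity) (iterate_jumpStep_nonneg hB (hp.nonneg 0 le_rfl) m x)

/-- A Harnack inequality between neighbouring states at the same time. -/
theorem IsLiftLaw.harnack (hp : IsLiftLaw Q w p) (hQ : IsRateMatrix Q)
    (hw : ∀ i, w i i = 0) (hB : ∀ i j, 0 ≤ uniformized Q c i j) {t : ℝ} (ht : 0 < t)
    (i j : V) (α : A) :
    uniformized Q c i j * t * p t (i, α) ^ 2 ≤ p t (j, α + w i j) *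
      (p t (i, α) + t * jumpStep (uniformized Q c) w (p t) (i, α)) := by
  set B := uniformized Q c with hBdef
  set a : ℕ → V × A → ℝ := fun m => (jumpStep B w)^[m] (p 0) with ha
  have ha0 : ∀ m x, 0 ≤ a m x := fun m x => iterate_jumpStep_nonneg hB (hp.nonneg 0 le_rfl) m x
  have hstep : ∀ m x, a (m + 1) x = jumpStep B w (a m) x := by
    intro m x
    simp only [ha, Function.iterate_succ_apply']
  set u : V × A → ℝ := fun x => Real.exp (c * t) * p t x with hu
  have hS : ∀ x, HasSum (fun m : ℕ => t ^ m / m.factorial * a m x) (u x) := fun x =>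
    hp.hasSum_uniformization hQ hw hB ht.le x
  set x : V × A := (i, α)
  set y : V × A := (j, α + w i j)
  have hSB : HasSum (fun m : ℕ => t ^ m / m.factorial * a (m + 1) x) (jumpStep B w u x) := by
    have h := hasSum_sum (s := Finset.univ) (fun k _ => (hS (k, x.2 - w k x.1)).mul_right (B k x.1))
    refine h.congr_terms fun m => ?_
    simp only [hstep, jumpStep, Finset.mul_sum, mul_assoc]
  -- Since `m / m! = 1 / (m - 1)!`, the factor `m` shifts the series by one index, which produces
  -- `t` times one more jump.
  have hN : HasSum (fun m : ℕ => (m : ℝ) * (t ^ m / m.factorial * a m x))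
      (t * jumpStep B w u x) := by
    rw [← hasSum_nat_add_iff' 1]
    simp only [Finset.range_one, Finset.sum_singleton, Nat.cast_zero, zero_mul, sub_zero]
    refine (hSB.mul_left t).congr_terms fun m => ?_
    rw [Nat.factorial_succ, pow_succ]
    push_cast
    have : (m.factorial : ℝ) ≠ 0 := by positivity
    field_simp
  -- One more jump along `i → j` bounds `u y` below by `B i j * t * ∑ s_m / (m + 1)`, with `s_m` the
  -- terms of the series at `x`. The tangent-line bound `1 / v ≥ 2 θ - θ ^ 2 v` at `v = m + 1`
  -- linearizes this; optimizing `θ` afterwards amounts to Cauchy–Schwarz.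
  have hlow : ∀ θ : ℝ, B i j * t * (2 * θ * u x - θ ^ 2 * (u x + t * jumpStep B w u x)) ≤ u y := by
    intro θ
    have h1 : HasSum (fun m : ℕ => t ^ (m + 1) / (m + 1).factorial * a (m + 1) y)
        (u y - t ^ 0 / (Nat.factorial 0) * a 0 y) := by
      have := (hasSum_nat_add_iff' 1).mpr (hS y)
      simpa using this
    have h2 : HasSum (fun m : ℕ => B i j * t * (2 * θ * (t ^ m / m.factorial * a m x) -
        θ ^ 2 * (t ^ m / m.factorial * a m x + m * (t ^ m / m.factorial * a m x))))
        (B i j * t * (2 * θ * u x - θ ^ 2 * (u x + t * jumpStep B w u x))) :=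
      (((hS x).mul_left _).sub (((hS x).add hN).mul_left _)).mul_left _
    have h3 := hasSum_le (fun m => ?_) h2 h1
    · have : 0 ≤ t ^ 0 / (Nat.factorial 0) * a 0 y := by
        have := ha0 0 y
        simpa using this
      linarith
    · have h4 : a m x * B i j ≤ a (m + 1) y := by
        rw [hstep]
        exact le_jumpStep hB (ha0 m) i j α
      have h5 : t ^ (m + 1) / (m + 1).factorial * (a m x * B i j) ≤
          t ^ (m + 1) / (m + 1).factorial * a (m + 1) y :=
        mul_le_mul_of_nonneg_left h4 (by positivity)
      refine le_trans ?_ h5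
      have h6 : t ^ (m + 1) / ((m + 1).factorial : ℝ) * (a m x * B i j) =
          B i j * t * (t ^ m / m.factorial * a m x) * (1 / (m + 1)) := by
        rw [Nat.factorial_succ, pow_succ]
        push_cast
        have : (m.factorial : ℝ) ≠ 0 := by positivity
        field_simp
      have h7 : (2 * θ - θ ^ 2 * (m + 1) : ℝ) ≤ 1 / (m + 1) := by
        have : (0 : ℝ) < m + 1 := by positivity
        rw [le_div_iff₀ this]
        nlinarith [sq_nonneg (θ * (m + 1) - 1)]
      rw [h6]
      have h8 : 0 ≤ B i j * t * (t ^ m / m.factorial * a m x) :=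
        mul_nonneg (mul_nonneg (hB i j) ht.le) (mul_nonneg (by positivity) (ha0 m x))
      have := mul_le_mul_of_nonneg_left h7 h8
      calc _ = B i j * t * (t ^ m / m.factorial * a m x) * (2 * θ - θ ^ 2 * (m + 1)) := by ring
        _ ≤ _ := this
  have huB : jumpStep B w u x = Real.exp (c * t) * jumpStep B w (p t) x := by
    simp only [jumpStep, hu, Finset.mul_sum, mul_assoc]
  have hE := Real.exp_pos (c * t)
  have hpx := hp.nonneg t ht.le x
  have hJ : 0 ≤ jumpStep B w (p t) x := jumpStep_nonneg hB (hp.nonneg t ht.le) x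
  have hlow' : ∀ θ : ℝ,
      B i j * t * (2 * θ * p t x - θ ^ 2 * (p t x + t * jumpStep B w (p t) x)) ≤ p t y := by
    intro θ
    have := hlow θ
    rw [huB] at this
    simp only [hu] at this
    refine le_of_mul_le_mul_left ?_ hE
    linarith
  rcases hpx.eq_or_lt with h0 | h0
  · rw [← h0]
    have := mul_nonneg (hp.nonneg t ht.le y) (mul_nonneg ht.le hJ)
    simpa using this
  · set D := p t x + t * jumpStep B w (p t) x with hD
    have hDpos : 0 < D := by positivity
    -- The maximizer of the quadratic in `θ`.
    have := hlow' (p t x / D)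
    have h9 : B i j * t * (2 * (p t x / D) * p t x - (p t x / D) ^ 2 * D) =
        B i j * t * p t x ^ 2 / D := by
      field_simp
      ring
    rw [h9, div_le_iff₀ hDpos] at this
    exact this

end Uniformization

/-! ### Evolution of expectations of test functions -/

section TestFunctions

/-- Exchange of sum and integral when the finite partial sums of norms have an integrable bound. -/
theorem hasSum_integral_of_sum_norm_le {ι α : Type*} [Countable ι] [MeasurableSpace α]
    {μ : Measure α} {F : ι → α → ℝ} {g : α → ℝ} (hF : ∀ i, AEStronglyMeasurable (F i) μ)
    (hg : Integrable g μ) (h : ∀ᵐ t ∂μ, ∀ s : Finset ι, ∑ i ∈ s, ‖F i t‖ ≤ g t) :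
    Integrable (fun t => ∑' i, F i t) μ ∧
      HasSum (fun i => ∫ t, F i t ∂μ) (∫ t, ∑' i, F i t ∂μ) := by
  have hsum : ∀ᵐ t ∂μ, Summable (fun i => ‖F i t‖) := by
    filter_upwards [h] with t ht
    exact summable_of_sum_le (fun i => norm_nonneg _) ht
  have hint : ∀ i, Integrable (F i) μ := fun i =>
    hg.mono' (hF i) (by
      filter_upwards [h] with t ht
      simpa using ht {i})
  refine ⟨?_, hasSum_integral_of_summable_integral_norm hint ?_⟩
  · refine hg.mono' ?_ ?_
    · refine aestronglyMeasurable_of_tendsto_ae (atTop : Filter (Finset ι))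
        (f := fun s t => ∑ i ∈ s, F i t)
        (fun s => Finset.aestronglyMeasurable_fun_sum s fun i _ => hF i) ?_
      filter_upwards [hsum] with t ht
      exact ht.of_norm.hasSum
    · filter_upwards [h, hsum] with t ht hs
      exact (norm_tsum_le_tsum_norm hs).trans (hs.tsum_le_of_sum_le ht)
  · refine summable_of_sum_le (c := ∫ t, g t ∂μ)
      (fun i => integral_nonneg fun t => norm_nonneg _) fun s => ?_
    rw [← integral_finsetSum s fun i _ => (hint i).norm]
    refine integral_mono_ae (integrable_finsetSum s fun i _ => (hint i).norm) hg ?_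
    filter_upwards [h] with t ht
    exact ht s

variable {V A : Type*} [Fintype V] [AddCommGroup A]
  {Q : Matrix V V ℝ} {w : V → V → A} {p : ℝ → V × A → ℝ}

/-- Duality: the substitution `β = α + w i j` moves the jump onto the test function. Summability is
asked only along non-zero rates, since for `f = -log p` the Harnack inequality gives it only there.
-/
theorem hasSum_jumpStep_mul {u f : V × A → ℝ}
    (h : ∀ i j, Q i j ≠ 0 → Summable (fun α => u (i, α) * f (j, α + w i j))) :
    HasSum (fun x => jumpStep Q w u x * f x)
      (∑ j, ∑ i, Q i j * ∑' α, u (i, α) * f (j, α + w i j)) := by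
  refine hasSum_prod_of_fintype fun j => ?_
  simp only [jumpStep, Finset.sum_mul]
  refine hasSum_sum fun i _ => ?_
  by_cases hq : Q i j = 0
  · simp [hq, hasSum_zero]
  · have h1 := ((Equiv.subRight (w i j)).hasSum_iff.mpr (h i j hq).hasSum).mul_left (Q i j)
    refine h1.congr_terms fun β => ?_
    simp only [Function.comp_apply, Equiv.subRight_apply, sub_add_cancel]
    ring

theorem sum_abs_jumpStep_mul_le {u f : V × A → ℝ} (hu : ∀ x, 0 ≤ u x)
    (h : ∀ i j, Q i j ≠ 0 → Summable (fun α => u (i, α) * |f (j, α + w i j)|))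
    (s : Finset (V × A)) :
    ∑ x ∈ s, ‖jumpStep Q w u x * f x‖ ≤
      ∑ j, ∑ i, |Q i j| * ∑' α, u (i, α) * |f (j, α + w i j)| := by
  have h1 := hasSum_jumpStep_mul (Q := fun i j => |Q i j|) (w := w) (u := u) (f := fun x => |f x|)
    (fun i j hij => h i j (by simpa using hij))
  have h0 : ∀ x, 0 ≤ jumpStep (fun i j => |Q i j|) w u x * |f x| := fun x =>
    mul_nonneg (jumpStep_nonneg (fun _ _ => abs_nonneg _) hu x) (abs_nonneg _)
  refine le_trans (Finset.sum_le_sum fun x _ => ?_) (sum_le_hasSum s (fun x _ => h0 x) h1)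
  rw [norm_mul, Real.norm_eq_abs, Real.norm_eq_abs]
  refine mul_le_mul_of_nonneg_right ?_ (abs_nonneg _)
  refine (Finset.abs_sum_le_sum_abs _ _).trans (Finset.sum_le_sum fun i _ => ?_)
  rw [abs_mul, abs_of_nonneg (hu _)]

theorem IsLiftLaw.le_one (hp : IsLiftLaw Q w p) {t : ℝ} (ht : 0 ≤ t) (x : V × A) : p t x ≤ 1 :=
  le_hasSum (hp.hasSum_one t ht) x fun y _ => hp.nonneg t ht y

theorem IsLiftLaw.summable_slice (hp : IsLiftLaw Q w p) {t : ℝ} (ht : 0 ≤ t) (i : V) :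
    Summable (fun α => p t (i, α)) := (hp.hasSum_one t ht).summable.slice i

theorem IsLiftLaw.sum_marginal (hp : IsLiftLaw Q w p) {t : ℝ} (ht : 0 ≤ t) :
    ∑ i, ∑' α, p t (i, α) = 1 := by
  rw [← tsum_slices (hp.hasSum_one t ht).summable, (hp.hasSum_one t ht).tsum_eq]

theorem IsLiftLaw.marginal_nonneg (hp : IsLiftLaw Q w p) {t : ℝ} (ht : 0 ≤ t) (i : V) :
    0 ≤ ∑' α, p t (i, α) := tsum_nonneg fun _ => hp.nonneg t ht _

theorem IsLiftLaw.marginal_le_one (hp : IsLiftLaw Q w p) {t : ℝ} (ht : 0 ≤ t) (i : V) :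
    ∑' α, p t (i, α) ≤ 1 := by
  rw [← hp.sum_marginal ht]
  exact Finset.single_le_sum (f := fun i => ∑' α, p t (i, α))
    (fun i _ => hp.marginal_nonneg ht i) (Finset.mem_univ i)

theorem IsLiftLaw.continuousOn_jumpStep (hp : IsLiftLaw Q w p) (x : V × A) :
    ContinuousOn (fun t => jumpStep Q w (p t) x) (Set.Ici 0) :=
  continuousOn_finsetSum _ fun _ _ => (hp.continuousOn _).mul continuousOn_const

theorem IsLiftLaw.aestronglyMeasurable (hp : IsLiftLaw Q w p) (T : ℝ) (x : V × A) :
    AEStronglyMeasurable (fun t => p t x) (volume.restrict (Set.Ioc 0 T)) :=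
  ((hp.continuousOn x).mono (fun _ ht => ht.1.le)).aestronglyMeasurable measurableSet_Ioc

theorem IsLiftLaw.aestronglyMeasurable_jumpStep (hp : IsLiftLaw Q w p) (T : ℝ) (x : V × A) :
    AEStronglyMeasurable (fun t => jumpStep Q w (p t) x) (volume.restrict (Set.Ioc 0 T)) :=
  ((hp.continuousOn_jumpStep x).mono (fun _ ht => ht.1.le)).aestronglyMeasurable
    measurableSet_Ioc

theorem IsLiftLaw.summable_mul (hp : IsLiftLaw Q w p) {t : ℝ} (ht : 0 ≤ t) (i : V) {f : A → ℝ}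
    {K : ℝ} (hf : ∀ α, |f α| ≤ K) : Summable (fun α => p t (i, α) * f α) := by
  refine Summable.of_norm_bounded ((hp.summable_slice ht i).mul_right K) fun α => ?_
  rw [norm_mul, Real.norm_of_nonneg (hp.nonneg t ht _)]
  exact mul_le_mul_of_nonneg_left (hf α) (hp.nonneg t ht _)

/-- Evolution of the expectation of a bounded test function. -/
theorem IsLiftLaw.integral_test [Countable A] (hp : IsLiftLaw Q w p) {f : V × A → ℝ} {K : ℝ}
    (hf : ∀ x, |f x| ≤ K) {T : ℝ} (hT : 0 ≤ T) :
    IntervalIntegrable (fun t => ∑ j, ∑ i, Q i j * ∑' α, p t (i, α) * f (j, α + w i j))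
      volume 0 T ∧
    ∫ t in (0 : ℝ)..T, ∑ j, ∑ i, Q i j * ∑' α, p t (i, α) * f (j, α + w i j) =
      ∑' x, p T x * f x - ∑' x, p 0 x * f x := by
  have hsumm : ∀ t, 0 ≤ t → ∀ i j, Summable (fun α => p t (i, α) * f (j, α + w i j)) :=
    fun t ht i j => hp.summable_mul ht i (fun α => hf _)
  have hsumm' : ∀ t, 0 ≤ t → ∀ i j, Summable (fun α => p t (i, α) * |f (j, α + w i j)|) :=
    fun t ht i j => hp.summable_mul ht i (K := K) (fun α => by simpa using hf _)
  have hK : ∀ t, 0 ≤ t → ∀ i j, ∑' α, p t (i, α) * |f (j, α + w i j)| ≤ K := by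
    intro t ht i j
    have h1 : ∑' α, p t (i, α) * |f (j, α + w i j)| ≤ ∑' α, p t (i, α) * K :=
      (hsumm' t ht i j).tsum_le_tsum
        (fun α => mul_le_mul_of_nonneg_left (hf _) (hp.nonneg t ht _))
        ((hp.summable_slice ht i).mul_right K)
    rw [tsum_mul_right] at h1
    have hK0 : 0 ≤ K := (abs_nonneg _).trans (hf (i, 0))
    nlinarith [hp.marginal_le_one ht i]
  obtain ⟨hint, hsum⟩ := hasSum_integral_of_sum_norm_le
    (μ := volume.restrict (Set.Ioc 0 T)) (F := fun x t => jumpStep Q w (p t) x * f x)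
    (g := fun _ => ∑ j, ∑ i, |Q i j| * K)
    (fun x => (hp.aestronglyMeasurable_jumpStep T x).mul_const _) (integrable_const _) (by
      filter_upwards [ae_restrict_mem measurableSet_Ioc] with t ht s
      refine (sum_abs_jumpStep_mul_le (hp.nonneg t ht.1.le)
        (fun i j _ => hsumm' t ht.1.le i j) s).trans ?_
      exact Finset.sum_le_sum fun j _ => Finset.sum_le_sum fun i _ =>
        mul_le_mul_of_nonneg_left (hK t ht.1.le i j) (abs_nonneg _))
  have hcongr : ∀ᵐ t ∂(volume.restrict (Set.Ioc 0 T)), ∑' x, jumpStep Q w (p t) x * f x =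
      ∑ j, ∑ i, Q i j * ∑' α, p t (i, α) * f (j, α + w i j) := by
    filter_upwards [ae_restrict_mem measurableSet_Ioc] with t ht
    exact (hasSum_jumpStep_mul (fun i j _ => hsumm t ht.1.le i j)).tsum_eq
  refine ⟨(intervalIntegrable_iff_integrableOn_Ioc_of_le hT).mpr (hint.congr hcongr), ?_⟩
  rw [intervalIntegral.integral_of_le hT, ← integral_congr_ae hcongr]
  refine hsum.unique ?_
  have hx : ∀ x, ∫ t in Set.Ioc 0 T, jumpStep Q w (p t) x * f x =
      p T x * f x - p 0 x * f x := by
    intro x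
    rw [integral_mul_const, ← intervalIntegral.integral_of_le hT,
      intervalIntegral.integral_eq_sub_of_hasDerivAt_of_le hT
        ((hp.continuousOn x).mono Set.Icc_subset_Ici_self)
        (fun t ht => hp.hasDerivAt ht.1 x), sub_mul]
    refine ContinuousOn.intervalIntegrable_of_Icc hT ?_
    exact (hp.continuousOn_jumpStep x).mono Set.Icc_subset_Ici_self
  simp only [hx]
  have hs : ∀ t, 0 ≤ t → Summable (fun x => p t x * f x) := by
    intro t ht
    exact (hasSum_prod_of_fintype (f := fun x => p t x * f x)
      fun i => (hp.summable_mul ht i (f := fun α => f (i, α)) (fun α => hf _)).hasSum).summable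
  exact (hs T hT).hasSum.sub (hs 0 le_rfl).hasSum

end TestFunctions

/-! ### Linear growth bound for the entropy -/

section EntropyGrowth

variable {V A : Type*} [AddCommGroup A]

/-- The initial law, projected to `A` and smoothed by the weight `q`. -/
noncomputable def smoothed (u : V × A → ℝ) (q : A → ℝ) (α : A) : ℝ :=
  ∑' x : V × A, u x * q (α - x.2)

theorem summable_smoothed {u : V × A → ℝ} {q : A → ℝ} (hu : ∀ x, 0 ≤ u x) (hus : Summable u)
    (hq : ∀ α, 0 < q α) (hq1 : ∀ α, q α ≤ 1) (α : A) :
    Summable (fun x : V × A => u x * q (α - x.2)) :=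
  Summable.of_nonneg_of_le (fun x => mul_nonneg (hu x) (hq _).le)
    (fun x => mul_le_of_le_one_right (hu x) (hq1 _)) hus

/-- Tonelli: convolution with a probability measure preserves the mass of `q`. -/
theorem hasSum_smoothed {u : V × A → ℝ} {q : A → ℝ} (hu : ∀ x, 0 ≤ u x) (hu1 : HasSum u 1)
    (hq : ∀ α, 0 < q α) (hq1 : ∀ α, q α ≤ 1) (hqs : Summable q) :
    HasSum (smoothed u q) (∑' α, q α) := by
  have hx : ∀ x : V × A, HasSum (fun α => u x * q (α - x.2)) (u x * ∑' α, q α) := fun x =>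
    HasSum.mul_left _ ((Equiv.subRight x.2).hasSum_iff.mpr hqs.hasSum)
  have htot : HasSum (fun x : V × A => u x * ∑' α, q α) (∑' α, q α) := by
    simpa using hu1.mul_right (∑' α, q α)
  have hprod : Summable (fun z : (V × A) × A => u z.1 * q (z.2 - z.1.2)) := by
    rw [summable_prod_of_nonneg (fun z => mul_nonneg (hu _) (hq _).le)]
    refine ⟨fun x => (hx x).summable, ?_⟩
    simp_rw [fun x => (hx x).tsum_eq]
    exact htot.summable
  have h1 : HasSum (fun z : (V × A) × A => u z.1 * q (z.2 - z.1.2)) (∑' α, q α) := by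
    have := hprod.hasSum.prod_fiberwise hx
    rw [← this.unique htot]
    exact hprod.hasSum
  exact ((Equiv.prodComm A (V × A)).hasSum_iff.mpr h1).prod_fiberwise
    (fun α => (summable_smoothed hu hu1.summable hq hq1 α).hasSum)

variable [Fintype V] {Q : Matrix V V ℝ} {w : V → V → A} {p : ℝ → V × A → ℝ}

/-- The expectation of a function of the `A`-coordinate that varies by at most `δ` along jumps
grows at most linearly, with slope proportional to `δ`. -/
theorem IsLiftLaw.tsum_mul_le_of_lipschitz [Countable A] (hp : IsLiftLaw Q w p)
    (hQ : IsRateMatrix Q) {f : A → ℝ} {K δ : ℝ} (hf : ∀ α, |f α| ≤ K)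
    (hδ : ∀ i j α, |f (α + w i j) - f α| ≤ δ) {T : ℝ} (hT : 0 ≤ T) :
    ∑' x : V × A, p T x * f x.2 ≤
      ∑' x : V × A, p 0 x * f x.2 + (∑ j, ∑ i, |Q i j|) * δ * T := by
  obtain ⟨hint, heq⟩ := hp.integral_test (f := fun x => f x.2) (fun x => hf x.2) hT
  have hle : ∀ t ∈ Set.Icc 0 T,
      ∑ j, ∑ i, Q i j * ∑' α, p t (i, α) * f (α + w i j) ≤ (∑ j, ∑ i, |Q i j|) * δ := by
    intro t ht
    -- The rows of `Q` sum to zero, so `f α` may be subtracted for free; only increments of `f`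
    -- along jumps remain.
    have h0 : ∑ j, ∑ i, Q i j * ∑' α, p t (i, α) * f α = 0 := by
      rw [Finset.sum_comm]
      refine Finset.sum_eq_zero fun i _ => ?_
      rw [← Finset.sum_mul, hQ.row_sum, zero_mul]
    rw [← sub_zero (∑ j, ∑ i, Q i j * ∑' α, p t (i, α) * f (α + w i j)), ← h0,
      ← Finset.sum_sub_distrib, Finset.sum_mul]
    refine Finset.sum_le_sum fun j _ => ?_
    rw [← Finset.sum_sub_distrib, Finset.sum_mul]
    refine Finset.sum_le_sum fun i _ => ?_
    have hs1 := hp.summable_mul ht.1 i (f := fun α => f (α + w i j)) (fun α => hf _)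
    have hs2 := hp.summable_mul ht.1 i (f := f) hf
    rw [← mul_sub, ← hs1.tsum_sub hs2]
    refine (le_abs_self _).trans ?_
    rw [abs_mul]
    refine mul_le_mul_of_nonneg_left ?_ (abs_nonneg _)
    have hδ0 : 0 ≤ δ := (abs_nonneg _).trans (hδ i j 0)
    have h1 := tsum_of_norm_bounded ((hp.summable_slice ht.1 i).hasSum.mul_right δ)
      (f := fun α => p t (i, α) * f (α + w i j) - p t (i, α) * f α) (fun α => by
        rw [← mul_sub, norm_mul, Real.norm_of_nonneg (hp.nonneg t ht.1 _)]
        exact mul_le_mul_of_nonneg_left (hδ i j α) (hp.nonneg t ht.1 _))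
    exact h1.trans (mul_le_of_le_one_left hδ0 (hp.marginal_le_one ht.1 i))
  have h3 := intervalIntegral.integral_mono_on hT hint
    (intervalIntegrable_const (c := (∑ j, ∑ i, |Q i j|) * δ)) hle
  rw [heq, intervalIntegral.integral_const, sub_zero, smul_eq_mul] at h3
  linarith

/-- The entropy grows at most linearly, with slope proportional to the logarithmic Lipschitz
constant of any positive summable weight on `A`. -/
theorem IsLiftLaw.entropy_le [Countable A] (hp : IsLiftLaw Q w p)
    (hQ : IsRateMatrix Q) {q : A → ℝ} {δ : ℝ} (hq : ∀ α, 0 < q α) (hq1 : ∀ α, q α ≤ 1)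
    (hq0 : q 0 = 1) (hqs : Summable q)
    (hqw : ∀ i j α, |Real.log (q (α + w i j)) - Real.log (q α)| ≤ δ)
    (hH : Summable (fun x => Real.negMulLog (p 0 x))) {T : ℝ} (hT : 0 ≤ T) :
    Summable (fun x => Real.negMulLog (p T x)) ∧
    ∑' x, Real.negMulLog (p T x) ≤ ∑' x, Real.negMulLog (p 0 x) +
      (∑ j, ∑ i, |Q i j|) * δ * T + Fintype.card V * ∑' α, q α := by
  have hp0 := hp.nonneg 0 le_rfl
  have hp1 := hp.hasSum_one 0 le_rfl
  set g := smoothed (p 0) q with hg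
  have hsm := summable_smoothed hp0 hp1.summable hq hq1
  have hge : ∀ x : V × A, p 0 x ≤ g x.2 := by
    intro x
    have := (hsm x.2).le_tsum x (fun y _ => mul_nonneg (hp0 y) (hq _).le)
    rw [sub_self, hq0, mul_one] at this
    exact this
  have hpos : ∀ α, 0 < g α := by
    intro α
    obtain ⟨x, hx⟩ : ∃ x, 0 < p 0 x := by
      by_contra! hcon
      have : p 0 = 0 := funext fun x => le_antisymm (hcon x) (hp0 x)
      rw [this] at hp1
      exact zero_ne_one (hasSum_zero.unique hp1)
    exact (mul_pos hx (hq _)).trans_le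
      ((hsm α).le_tsum x (fun y _ => mul_nonneg (hp0 y) (hq _).le))
  have hle1 : ∀ α, g α ≤ 1 := by
    intro α
    rw [← hp1.tsum_eq]
    exact (hsm α).tsum_le_tsum (fun x => mul_le_of_le_one_right (hp0 x) (hq1 _)) hp1.summable
  have hqexp : ∀ i j α, q α ≤ Real.exp δ * q (α + w i j) ∧ q (α + w i j) ≤ Real.exp δ * q α := by
    intro i j α
    have h := abs_le.mp (hqw i j α)
    rw [← Real.exp_log (hq α), ← Real.exp_log (hq (α + w i j)), ← Real.exp_add, ← Real.exp_add,
      Real.exp_le_exp, Real.exp_le_exp]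
    constructor <;> linarith
  have hgexp : ∀ i j α, g α ≤ Real.exp δ * g (α + w i j) ∧ g (α + w i j) ≤ Real.exp δ * g α := by
    intro i j α
    simp only [hg, smoothed, ← tsum_mul_left]
    constructor
    · refine (hsm α).tsum_le_tsum (fun x => ?_) ((hsm _).mul_left _)
      have := (hqexp i j (α - x.2)).1
      rw [show α + w i j - x.2 = α - x.2 + w i j by abel]
      nlinarith [hp0 x]
    · refine (hsm _).tsum_le_tsum (fun x => ?_) ((hsm _).mul_left _)
      have := (hqexp i j (α - x.2)).2
      rw [show α + w i j - x.2 = α - x.2 + w i j by abel]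
      nlinarith [hp0 x]
  set φ : A → ℝ := fun α => -Real.log (g α) with hφ
  have hφ0 : ∀ α, 0 ≤ φ α := fun α =>
    neg_nonneg.mpr (Real.log_nonpos (hpos α).le (hle1 α))
  have hφw : ∀ i j α, |φ (α + w i j) - φ α| ≤ δ := by
    intro i j α
    have h := hgexp i j α
    have h1 := Real.log_le_log (hpos _) h.1
    have h2 := Real.log_le_log (hpos _) h.2
    rw [Real.log_mul (Real.exp_pos _).ne' (hpos _).ne', Real.log_exp] at h1 h2
    simp only [hφ]
    rw [abs_le]
    constructor <;> linarith
  -- As `q 0 = 1`, the smoothed weight dominates the initial law, so the mean of `-log g` starts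
  -- below the initial entropy.
  have hstart : ∀ K : ℝ, 0 ≤ K →
      ∑' x : V × A, p 0 x * min (φ x.2) K ≤ ∑' x, Real.negMulLog (p 0 x) := by
    intro K hK
    refine Summable.tsum_le_tsum (fun x => ?_) ?_ hH
    · rcases (hp0 x).eq_or_lt with h | h
      · simp [← h]
      · have h1 := Real.log_le_log h (hge x)
        have h2 : min (φ x.2) K ≤ -Real.log (p 0 x) :=
          (min_le_left _ _).trans (neg_le_neg h1)
        rw [Real.negMulLog, neg_mul, ← mul_neg]
        exact mul_le_mul_of_nonneg_left h2 h.le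
    · refine (hp1.summable.mul_right K).of_nonneg_of_le
        (fun x => mul_nonneg (hp0 x) (le_min (hφ0 _) hK)) (fun x => ?_)
      exact mul_le_mul_of_nonneg_left (min_le_right _ _) (hp0 x)
  set b := ∑' x, Real.negMulLog (p 0 x) + (∑ j, ∑ i, |Q i j|) * δ * T with hb
  have hpT := hp.nonneg T hT
  have hfin : ∀ s : Finset (V × A), ∑ x ∈ s, p T x * φ x.2 ≤ b := by
    intro s
    -- The growth estimate needs a bounded function, so `φ` is truncated at a level high enough to
    -- be invisible on `s`.
    set K := ∑ x ∈ s, φ x.2 with hK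
    have hK0 : 0 ≤ K := Finset.sum_nonneg fun x _ => hφ0 _
    have habs : ∀ α, |min (φ α) K| ≤ K := fun α => by
      rw [abs_of_nonneg (le_min (hφ0 _) hK0)]
      exact min_le_right _ _
    have h1 : ∑ x ∈ s, p T x * φ x.2 = ∑ x ∈ s, p T x * min (φ x.2) K := by
      refine Finset.sum_congr rfl fun x hx => ?_
      rw [min_eq_left]
      exact Finset.single_le_sum (f := fun x : V × A => φ x.2) (fun y _ => hφ0 _) hx
    have h2 : Summable (fun x : V × A => p T x * min (φ x.2) K) :=
      ((hp.hasSum_one T hT).summable.mul_right K).of_nonneg_of_le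
        (fun x => mul_nonneg (hpT x) (le_min (hφ0 _) hK0))
        (fun x => mul_le_mul_of_nonneg_left (min_le_right _ _) (hpT x))
    have h3 := h2.sum_le_tsum s (fun x _ => mul_nonneg (hpT x) (le_min (hφ0 _) hK0))
    have h4 := hp.tsum_mul_le_of_lipschitz hQ (f := fun α => min (φ α) K) habs (δ := δ)
      (fun i j α => by
        refine (abs_min_sub_min_le_max _ _ _ _).trans ?_
        rw [sub_self, abs_zero]
        exact max_le (hφw i j α) ((abs_nonneg _).trans (hφw i j α))) hT
    have h5 := hstart K hK0
    linarith
  have hs1 : Summable (fun x : V × A => p T x * φ x.2) :=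
    summable_of_sum_le (fun x => mul_nonneg (hpT x) (hφ0 _)) hfin
  have hs2 : HasSum (fun x : V × A => g x.2) (Fintype.card V * ∑' α, q α) := by
    have := hasSum_prod_of_fintype (f := fun x : V × A => g x.2) (a := fun _ => ∑' α, q α)
      (fun _ => hasSum_smoothed hp0 hp1 hq hq1 hqs)
    simpa using this
  -- Pointwise Gibbs inequality, from `log z ≤ z - 1` at `z = g x.2 / p T x`.
  have hpt : ∀ x, Real.negMulLog (p T x) ≤ p T x * φ x.2 + g x.2 := by
    intro x
    rcases (hpT x).eq_or_lt with h | h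
    · rw [← h]
      simpa using (hpos x.2).le
    · have h1 := Real.log_le_sub_one_of_pos (div_pos (hpos x.2) h)
      rw [Real.log_div (hpos x.2).ne' h.ne'] at h1
      have h2 := mul_le_mul_of_nonneg_left h1 h.le
      have h3 : p T x * (g x.2 / p T x - 1) = g x.2 - p T x := by field_simp
      rw [Real.negMulLog]
      simp only [hφ]
      nlinarith
  have hs3 : Summable (fun x => Real.negMulLog (p T x)) :=
    (hs1.add hs2.summable).of_nonneg_of_le
      (fun x => Real.negMulLog_nonneg (hpT x) (hp.le_one hT x)) hpt
  refine ⟨hs3, (hs3.tsum_le_tsum hpt (hs1.add hs2.summable)).trans ?_⟩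
  rw [hs1.tsum_add hs2.summable, hs2.tsum_eq]
  have := hs1.tsum_le_of_sum_le hfin
  linarith

end EntropyGrowth

/-! ### Slowly varying summable weights on `ℤⁿ` -/

section LatticeWeight

theorem summable_prod_pi {n : ℕ} {g : ℤ → ℝ} (hg0 : ∀ k, 0 ≤ g k) (hg : Summable g) :
    Summable (fun α : Fin n → ℤ => ∏ k, g (α k)) := by
  induction n with
  | zero => exact Summable.of_finite
  | succ n ih =>
    rw [← (Fin.consEquiv (fun _ => ℤ)).summable_iff]
    have h := hg.mul_of_nonneg ih hg0 (fun α => Finset.prod_nonneg fun k _ => hg0 _)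
    refine h.congr fun z => ?_
    simp [Fin.prod_univ_succ, Fin.consEquiv]

theorem summable_exp_neg_abs {ε : ℝ} (hε : 0 < ε) :
    Summable (fun k : ℤ => Real.exp (-ε * |(k : ℝ)|)) := by
  have h : Summable (fun k : ℕ => Real.exp (-ε * |((k : ℤ) : ℝ)|)) := by
    have := summable_geometric_of_lt_one (Real.exp_pos (-ε)).le
      (Real.exp_lt_one_iff.mpr (by linarith : -ε < 0))
    refine this.congr fun k => ?_
    rw [← Real.exp_nat_mul]
    simp [mul_comm]
  refine Summable.of_nat_of_neg h ?_
  refine h.congr fun k => ?_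
  simp

/-- The exponential weight `exp (-ε |α|₁)` on `ℤⁿ`. -/
noncomputable def latticeWeight {n : ℕ} (ε : ℝ) (α : Fin n → ℤ) : ℝ :=
  ∏ k, Real.exp (-ε * |(α k : ℝ)|)

theorem log_latticeWeight {n : ℕ} (ε : ℝ) (α : Fin n → ℤ) :
    Real.log (latticeWeight ε α) = -ε * ∑ k, |(α k : ℝ)| := by
  rw [latticeWeight, ← Real.exp_sum, Real.log_exp, Finset.mul_sum]

theorem latticeWeight_pos {n : ℕ} (ε : ℝ) (α : Fin n → ℤ) : 0 < latticeWeight ε α :=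
  Finset.prod_pos fun _ _ => Real.exp_pos _

theorem latticeWeight_le_one {n : ℕ} {ε : ℝ} (hε : 0 ≤ ε) (α : Fin n → ℤ) :
    latticeWeight ε α ≤ 1 := by
  refine Finset.prod_le_one (fun k _ => (Real.exp_pos _).le) fun k _ => ?_
  rw [Real.exp_le_one_iff]
  nlinarith [abs_nonneg (α k : ℝ)]

theorem latticeWeight_zero {n : ℕ} (ε : ℝ) : latticeWeight ε (0 : Fin n → ℤ) = 1 := by
  simp [latticeWeight]

theorem summable_latticeWeight {n : ℕ} {ε : ℝ} (hε : 0 < ε) :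
    Summable (latticeWeight (n := n) ε) := by
  have h := summable_prod_pi (n := n) (g := fun k : ℤ => Real.exp (-ε * |(k : ℝ)|))
    (fun k => (Real.exp_pos _).le) (summable_exp_neg_abs hε)
  exact h

theorem abs_log_latticeWeight_sub_le {n : ℕ} {ε : ℝ} (hε : 0 ≤ ε) (α β : Fin n → ℤ) :
    |Real.log (latticeWeight ε (α + β)) - Real.log (latticeWeight ε α)| ≤
      ε * ∑ k, |(β k : ℝ)| := by
  rw [log_latticeWeight, log_latticeWeight, ← mul_sub, abs_mul, abs_neg, abs_of_nonneg hε,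
    ← Finset.sum_sub_distrib]
  refine mul_le_mul_of_nonneg_left ?_ hε
  refine (Finset.abs_sum_le_sum_abs _ _).trans (Finset.sum_le_sum fun k _ => ?_)
  refine (abs_abs_sub_abs_le_abs_sub _ _).trans (le_of_eq ?_)
  rw [Pi.add_apply, Int.cast_add, add_sub_cancel_left]

/-- There are positive summable weights on `ℤⁿ` whose logarithm varies arbitrarily little along
finitely many steps. -/
theorem exists_lattice_weight {V : Type*} [Fintype V] {n : ℕ} (w : V → V → Fin n → ℤ) {δ : ℝ}
    (hδ : 0 < δ) :
    ∃ q : (Fin n → ℤ) → ℝ, (∀ α, 0 < q α) ∧ (∀ α, q α ≤ 1) ∧ q 0 = 1 ∧ Summable q ∧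
      ∀ i j α, |Real.log (q (α + w i j)) - Real.log (q α)| ≤ δ := by
  obtain ⟨W, hW⟩ := (Set.finite_range
    (fun z : V × V => ∑ k, |(w z.1 z.2 k : ℝ)|)).bddAbove
  have hW' : ∀ i j, ∑ k, |(w i j k : ℝ)| ≤ |W| + 1 := fun i j => by
    have := hW ⟨(i, j), rfl⟩
    have h2 := le_abs_self W
    simp only at this
    linarith
  have hW1 : 0 < |W| + 1 := by positivity
  have hε : 0 < δ / (|W| + 1) := by positivity
  refine ⟨latticeWeight (δ / (|W| + 1)), latticeWeight_pos _, latticeWeight_le_one hε.le,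
    latticeWeight_zero _, summable_latticeWeight hε, fun i j α => ?_⟩
  refine (abs_log_latticeWeight_sub_le hε.le _ _).trans ?_
  refine (mul_le_mul_of_nonneg_left (hW' i j) hε.le).trans (le_of_eq ?_)
  exact div_mul_cancel₀ _ hW1.ne'

end LatticeWeight

/-! ### Cross entropies and the derivative of the entropy -/

section EntropyBalance

variable {V A : Type*} [Fintype V] [AddCommGroup A]
  {Q : Matrix V V ℝ} {w : V → V → A} {p : ℝ → V × A → ℝ}

/-- The mean surprisal of the state reached by an attempted jump `i → j` from the law `u`. -/
noncomputable def crossEntropy (w : V → V → A) (u : V × A → ℝ) (i j : V) : ℝ :=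
  ∑' α, u (i, α) * -Real.log (u (j, α + w i j))

/-- A zero at the target would make the right side of the Harnack inequality zero while its left
side is positive. -/
theorem IsLiftLaw.ne_zero_of_rate_ne_zero (hp : IsLiftLaw Q w p) (hQ : IsRateMatrix Q)
    (hw : ∀ i, w i i = 0) {t : ℝ} (ht : 0 < t) {i j : V} (hij : Q i j ≠ 0) {α : A}
    (h : p t (i, α) ≠ 0) : p t (j, α + w i j) ≠ 0 := by
  classical
  by_cases heq : i = j
  · subst heq
    rwa [hw, add_zero]
  · obtain ⟨c, -, hB⟩ := hQ.exists_uniformized_nonneg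
    intro h0
    have h1 := hp.harnack hQ hw hB ht i j α
    rw [h0, zero_mul, uniformized_of_ne _ heq] at h1
    have h2 : 0 < Q i j := lt_of_le_of_ne (hQ.nonneg i j heq) hij.symm
    have h3 : 0 < p t (i, α) := lt_of_le_of_ne (hp.nonneg t ht.le _) h.symm
    have : 0 < Q i j * t * p t (i, α) ^ 2 := by positivity
    linarith

theorem IsLiftLaw.neg_log_nonneg (hp : IsLiftLaw Q w p) {t : ℝ} (ht : 0 ≤ t) (x : V × A) :
    0 ≤ -Real.log (p t x) :=
  neg_nonneg.mpr (Real.log_nonpos (hp.nonneg t ht x) (hp.le_one ht x))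

/-- The logarithm of the Harnack inequality, with `log (D / p) ≤ D / p - 1` for its second factor
`D`. Multiplying by `p` cancels the denominator and leaves summable terms. -/
theorem IsLiftLaw.mul_neg_log_le [DecidableEq V] (hp : IsLiftLaw Q w p) (hQ : IsRateMatrix Q)
    (hw : ∀ i, w i i = 0) {c : ℝ} (hB : ∀ i j, 0 ≤ uniformized Q c i j) {t : ℝ} (ht : 0 < t)
    {i j : V} (hij : Q i j ≠ 0) (α : A) :
    p t (i, α) * -Real.log (p t (j, α + w i j)) ≤ Real.negMulLog (p t (i, α)) +
      t * jumpStep (uniformized Q c) w (p t) (i, α) + p t (i, α) * |Real.log (Q i j * t)| := by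
  have hJ : 0 ≤ jumpStep (uniformized Q c) w (p t) (i, α) :=
    jumpStep_nonneg hB (hp.nonneg t ht.le) _
  rcases (hp.nonneg t ht.le (i, α)).eq_or_lt with h | h
  · rw [← h]
    simpa using mul_nonneg ht.le hJ
  have hL : 0 ≤ p t (i, α) * |Real.log (Q i j * t)| := mul_nonneg h.le (abs_nonneg _)
  by_cases heq : i = j
  · subst heq
    rw [hw, add_zero, Real.negMulLog]
    nlinarith [mul_nonneg ht.le hJ]
  have hQ0 : 0 < Q i j := lt_of_le_of_ne (hQ.nonneg i j heq) hij.symm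
  have hy : 0 < p t (j, α + w i j) := lt_of_le_of_ne (hp.nonneg t ht.le _)
    (hp.ne_zero_of_rate_ne_zero hQ hw ht hij h.ne').symm
  have h1 := hp.harnack hQ hw hB ht i j α
  rw [uniformized_of_ne _ heq] at h1
  set D := p t (i, α) + t * jumpStep (uniformized Q c) w (p t) (i, α) with hD
  have hDpos : 0 < D := by positivity
  have h2 := Real.log_le_log (by positivity) h1
  rw [Real.log_mul (by positivity) (by positivity), Real.log_pow,
    Real.log_mul hy.ne' hDpos.ne'] at h2
  have h3 := Real.log_le_sub_one_of_pos (div_pos hDpos h)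
  rw [Real.log_div hDpos.ne' h.ne'] at h3
  have h4 := neg_abs_le (Real.log (Q i j * t))
  push_cast at h2
  have h5 : -Real.log (p t (j, α + w i j)) ≤
      -Real.log (p t (i, α)) + (D / p t (i, α) - 1) + |Real.log (Q i j * t)| := by linarith
  have h6 := mul_le_mul_of_nonneg_left h5 h.le
  have h7 : p t (i, α) * (D / p t (i, α) - 1) =
      t * jumpStep (uniformized Q c) w (p t) (i, α) := by
    rw [hD]
    field_simp
    ring
  rw [mul_add, mul_add, h7] at h6
  rw [Real.negMulLog]
  linarith

/-- Sum `IsLiftLaw.mul_neg_log_le` over `α`: the jump term has total mass `c`, the uniformization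
constant. The bound is singular at `t = 0` only through an integrable logarithm. -/
theorem IsLiftLaw.crossEntropy_bound (hp : IsLiftLaw Q w p)
    (hQ : IsRateMatrix Q) (hw : ∀ i, w i i = 0) :
    ∃ c, ∀ t, 0 < t → Summable (fun x => Real.negMulLog (p t x)) → ∀ i j, Q i j ≠ 0 →
      Summable (fun α => p t (i, α) * -Real.log (p t (j, α + w i j))) ∧
      crossEntropy w (p t) i j ≤
        ∑' x, Real.negMulLog (p t x) + t * c + |Real.log (Q i j * t)| := by
  classical
  obtain ⟨c, hc, hB⟩ := hQ.exists_uniformized_nonneg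
  refine ⟨c, fun t ht hs i j hij => ?_⟩
  have hJ := hasSum_jumpStep_of_row_sum (w := w) (uniformized_row_sum hQ c) (hp.hasSum_one t ht.le)
  rw [one_mul] at hJ
  have hslice : ∀ f : V × A → ℝ, (∀ x, 0 ≤ f x) → Summable f →
      ∑' α, f (i, α) ≤ ∑' x, f x := by
    intro f hf hfs
    rw [tsum_slices hfs]
    exact Finset.single_le_sum (f := fun i => ∑' α, f (i, α))
      (fun i _ => tsum_nonneg fun α => hf _) (Finset.mem_univ i)
  have hn0 : ∀ x, 0 ≤ Real.negMulLog (p t x) := fun x =>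
    Real.negMulLog_nonneg (hp.nonneg t ht.le x) (hp.le_one ht.le x)
  have hJ0 : ∀ x, 0 ≤ jumpStep (uniformized Q c) w (p t) x :=
    jumpStep_nonneg hB (hp.nonneg t ht.le)
  have hmaj := (((hs.slice i).hasSum.add ((hJ.summable.slice i).hasSum.mul_left t)).add
    ((hp.summable_slice ht.le i).hasSum.mul_right |Real.log (Q i j * t)|))
  have hsum : Summable (fun α => p t (i, α) * -Real.log (p t (j, α + w i j))) :=
    hmaj.summable.of_nonneg_of_le
      (fun α => mul_nonneg (hp.nonneg t ht.le _) (hp.neg_log_nonneg ht.le _))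
      (hp.mul_neg_log_le hQ hw hB ht hij)
  refine ⟨hsum, (hasSum_le (hp.mul_neg_log_le hQ hw hB ht hij) hsum.hasSum hmaj).trans ?_⟩
  have h1 := hslice _ hn0 hs
  have h2 := hslice _ hJ0 hJ.summable
  rw [hJ.tsum_eq] at h2
  have h3 := mul_le_mul_of_nonneg_left h2 ht.le
  have h4 := mul_le_of_le_one_left (abs_nonneg (Real.log (Q i j * t)))
    (hp.marginal_le_one ht.le i)
  linarith

/-- `negMulLog` is not differentiable at `0`, but a state of probability zero at some positive time
has it at all times, so both sides then vanish. -/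
theorem IsLiftLaw.hasDerivAt_negMulLog (hp : IsLiftLaw Q w p) (hQ : IsRateMatrix Q)
    (hw : ∀ i, w i i = 0) {t : ℝ} (ht : 0 < t) (x : V × A) :
    HasDerivAt (fun s => Real.negMulLog (p s x))
      (jumpStep Q w (p t) x * (-Real.log (p t x) - 1)) t := by
  classical
  by_cases h : p t x = 0
  · have h1 : (fun s => p s x) =ᶠ[𝓝 t] fun _ => 0 := by
      filter_upwards [Ioi_mem_nhds ht] with s hs
      exact hp.eq_zero_of_eq_zero hQ hw ht (le_of_lt hs) h
    have h2 : jumpStep Q w (p t) x = 0 :=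
      (hp.hasDerivAt ht x).unique ((hasDerivAt_const t (0 : ℝ)).congr_of_eventuallyEq h1)
    rw [h2, zero_mul]
    refine (hasDerivAt_const t (0 : ℝ)).congr_of_eventuallyEq ?_
    filter_upwards [h1] with s hs
    simp [hs]
  · have := (Real.hasDerivAt_negMulLog h).comp t (hp.hasDerivAt ht x)
    rwa [mul_comm] at this

/-- The time derivative of the entropy, as a sum over the states. -/
theorem IsLiftLaw.hasSum_entropy_deriv (hp : IsLiftLaw Q w p) (hQ : IsRateMatrix Q)
    {t : ℝ} (ht : 0 < t)
    (hs : ∀ i j, Q i j ≠ 0 → Summable (fun α => p t (i, α) * -Real.log (p t (j, α + w i j)))) :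
    HasSum (fun x => jumpStep Q w (p t) x * (-Real.log (p t x) - 1))
      (∑ j, ∑ i, Q i j * crossEntropy w (p t) i j) := by
  have h1 : ∀ i j, Q i j ≠ 0 →
      HasSum (fun α => p t (i, α) * (-Real.log (p t (j, α + w i j)) - 1))
        (crossEntropy w (p t) i j - ∑' α, p t (i, α)) := by
    intro i j hij
    refine ((hs i j hij).hasSum.sub (hp.summable_slice ht.le i).hasSum).congr_terms fun α => ?_
    ring
  have h2 := hasSum_jumpStep_mul (Q := Q) (w := w) (u := p t)
    (f := fun x => -Real.log (p t x) - 1) (fun i j hij => (h1 i j hij).summable)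
  have h3 : ∑ j, ∑ i, Q i j * ∑' α, p t (i, α) * (-Real.log (p t (j, α + w i j)) - 1) =
      ∑ j, ∑ i, Q i j * crossEntropy w (p t) i j := by
    -- Conservation of mass removes the constant `-1` from the derivative of `-p log p`.
    have h4 : ∑ j, ∑ i, Q i j * ∑' α, p t (i, α) = 0 := by
      rw [Finset.sum_comm]
      refine Finset.sum_eq_zero fun i _ => ?_
      rw [← Finset.sum_mul, hQ.row_sum, zero_mul]
    rw [← sub_zero (∑ j, ∑ i, Q i j * crossEntropy w (p t) i j), ← h4, ← Finset.sum_sub_distrib]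
    refine Finset.sum_congr rfl fun j _ => ?_
    rw [← Finset.sum_sub_distrib]
    refine Finset.sum_congr rfl fun i _ => ?_
    by_cases hij : Q i j = 0
    · simp [hij]
    · rw [(h1 i j hij).tsum_eq]
      ring
  rwa [h3] at h2

theorem integrableOn_const_add_abs_log (K T : ℝ) :
    IntegrableOn (fun t => K + |Real.log t|) (Set.Ioc 0 T) := by
  rcases le_total 0 T with hT | hT
  · have h : IntervalIntegrable (fun t => K + |Real.log t|) volume 0 T :=
      intervalIntegrable_const.add intervalIntegral.intervalIntegrable_log'.abs
    exact (intervalIntegrable_iff_integrableOn_Ioc_of_le hT).mp h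
  · simp [Set.Ioc_eq_empty (not_lt.mpr hT)]

/-- The entropy is absolutely continuous, with the expected derivative. -/
theorem IsLiftLaw.integral_entropy_deriv [Countable A] (hp : IsLiftLaw Q w p)
    (hQ : IsRateMatrix Q) (hw : ∀ i, w i i = 0) {T b : ℝ} (hT : 0 ≤ T)
    (hs : ∀ t, 0 ≤ t → Summable (fun x => Real.negMulLog (p t x)))
    (hb : ∀ t ∈ Set.Ioc 0 T, ∑' x, Real.negMulLog (p t x) ≤ b) :
    IntervalIntegrable (fun t => ∑ j, ∑ i, Q i j * crossEntropy w (p t) i j) volume 0 T ∧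
    ∫ t in (0 : ℝ)..T, ∑ j, ∑ i, Q i j * crossEntropy w (p t) i j =
      ∑' x, Real.negMulLog (p T x) - ∑' x, Real.negMulLog (p 0 x) := by
  obtain ⟨c, hc⟩ := hp.crossEntropy_bound hQ hw
  -- A dominating function from `crossEntropy_bound`; the `+ 1` pays for the constant in `|-log p -
  -- 1| ≤ -log p + 1`.
  set g : ℝ → ℝ := fun t => ∑ j, ∑ i, |Q i j| * ((b + T * |c| + |Real.log (Q i j)| + 1) +
    |Real.log t|) with hg
  have hgint : IntegrableOn g (Set.Ioc 0 T) :=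
    integrable_finsetSum _ fun j _ => integrable_finsetSum _ fun i _ =>
      (integrableOn_const_add_abs_log _ T).const_mul _
  set F : V × A → ℝ → ℝ := fun x t => jumpStep Q w (p t) x * (-Real.log (p t x) - 1) with hF
  have hmeas : ∀ x, AEStronglyMeasurable (F x) (volume.restrict (Set.Ioc 0 T)) := by
    intro x
    refine (hp.aestronglyMeasurable_jumpStep T x).mul ?_
    exact ((Real.measurable_log.comp_aemeasurable
      (hp.aestronglyMeasurable T x).aemeasurable).neg.sub_const 1).aestronglyMeasurable
  have hbound : ∀ t ∈ Set.Ioc 0 T, ∀ s : Finset (V × A), ∑ x ∈ s, ‖F x t‖ ≤ g t := by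
    intro t ht s
    have habs : ∀ x, |(-Real.log (p t x) - 1)| ≤ -Real.log (p t x) + 1 := by
      intro x
      have := hp.neg_log_nonneg ht.1.le x
      rw [abs_le]
      constructor <;> linarith
    have hmaj : ∀ i j, Q i j ≠ 0 →
        HasSum (fun α => p t (i, α) * (-Real.log (p t (j, α + w i j)) + 1))
          (crossEntropy w (p t) i j + ∑' α, p t (i, α)) := by
      intro i j hij
      refine ((hc t ht.1 (hs t ht.1.le) i j hij).1.hasSum.add
        (hp.summable_slice ht.1.le i).hasSum).congr_terms fun α => ?_
      ring
    have hsum : ∀ i j, Q i j ≠ 0 →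
        Summable (fun α => p t (i, α) * |(-Real.log (p t (j, α + w i j)) - 1)|) := by
      intro i j hij
      exact (hmaj i j hij).summable.of_nonneg_of_le
        (fun α => mul_nonneg (hp.nonneg t ht.1.le _) (abs_nonneg _))
        (fun α => mul_le_mul_of_nonneg_left (habs _) (hp.nonneg t ht.1.le _))
    have h0 := sum_abs_jumpStep_mul_le (f := fun x => -Real.log (p t x) - 1)
      (hp.nonneg t ht.1.le) hsum s
    refine h0.trans (Finset.sum_le_sum fun j _ => Finset.sum_le_sum fun i _ => ?_)
    by_cases hij : Q i j = 0
    · rw [hij, abs_zero, zero_mul, zero_mul]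
    refine mul_le_mul_of_nonneg_left ?_ (abs_nonneg _)
    have h1 := hasSum_le
      (fun α => mul_le_mul_of_nonneg_left (habs (j, α + w i j)) (hp.nonneg t ht.1.le (i, α)))
      (hsum i j hij).hasSum (hmaj i j hij)
    have h2 := (hc t ht.1 (hs t ht.1.le) i j hij).2
    have h3 := hb t ht
    have h4 := hp.marginal_le_one ht.1.le i
    have h5 : t * c ≤ T * |c| := by
      have := le_abs_self c
      nlinarith [ht.1, ht.2, abs_nonneg c]
    have h6 : |Real.log (Q i j * t)| ≤ |Real.log (Q i j)| + |Real.log t| := by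
      rw [Real.log_mul hij ht.1.ne']
      exact abs_add_le _ _
    linarith
  obtain ⟨hint, hsum⟩ := hasSum_integral_of_sum_norm_le hmeas hgint (by
    filter_upwards [ae_restrict_mem measurableSet_Ioc] with t ht s
    exact hbound t ht s)
  have hcongr : ∀ᵐ t ∂(volume.restrict (Set.Ioc 0 T)), ∑' x, F x t =
      ∑ j, ∑ i, Q i j * crossEntropy w (p t) i j := by
    filter_upwards [ae_restrict_mem measurableSet_Ioc] with t ht
    exact (hp.hasSum_entropy_deriv hQ ht.1
      (fun i j hij => (hc t ht.1 (hs t ht.1.le) i j hij).1)).tsum_eq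
  refine ⟨(intervalIntegrable_iff_integrableOn_Ioc_of_le hT).mpr (hint.congr hcongr), ?_⟩
  rw [intervalIntegral.integral_of_le hT, ← integral_congr_ae hcongr]
  refine hsum.unique ?_
  refine ((hs T hT).hasSum.sub (hs 0 le_rfl).hasSum).congr_terms fun x => ?_
  rw [← intervalIntegral.integral_of_le hT]
  -- The derivative may blow up at `0`; continuity there and integrability of the derivative are
  -- enough.
  refine (intervalIntegral.integral_eq_sub_of_hasDerivAt_of_le hT
    (Real.continuous_negMulLog.comp_continuousOn
      ((hp.continuousOn x).mono Set.Icc_subset_Ici_self))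
    (fun t ht => hp.hasDerivAt_negMulLog hQ hw ht.1 x) ?_).symm
  rw [intervalIntegrable_iff_integrableOn_Ioc_of_le hT]
  refine hgint.mono' (hmeas x) ?_
  filter_upwards [ae_restrict_mem measurableSet_Ioc] with t ht
  have := hbound t ht {x}
  rwa [Finset.sum_singleton] at this

end EntropyBalance

/-! ### Splitting the production into entropy gain and flux -/

section EntropyProduction

variable {V A : Type*}

/-- The rates of the chain on `V × A` that jumps from `(i, α)` to `(j, α + w i j)`. -/
def latticeRate [AddCommGroup A] [DecidableEq A] (Q : Matrix V V ℝ) (w : V → V → A)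
    (x y : V × A) : ℝ :=
  if y.2 = x.2 + w x.1 y.1 then Q x.1 y.1 else 0

theorem IsRateMatrix.eq_zero_comm [Fintype V] {Q : Matrix V V ℝ} (hQ : IsRateMatrix Q)
    (hsymm : ∀ i j, 0 < Q i j ↔ 0 < Q j i) (i j : V) : Q i j = 0 ↔ Q j i = 0 := by
  by_cases h : i = j
  · rw [h]
  · have h1 := hQ.nonneg i j h
    have h2 := hQ.nonneg j i (Ne.symm h)
    have h3 := hsymm i j
    constructor
    · intro h4
      rw [h4] at h3
      exact le_antisymm (not_lt.mp fun h5 => lt_irrefl _ (h3.mpr h5)) h2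
    · intro h4
      rw [h4] at h3
      exact le_antisymm (not_lt.mp fun h5 => lt_irrefl _ (h3.mp h5)) h1

/-- The logarithmic terms of an entropy production rate, when the two fluxes vanish together. -/
theorem flux_mul_log_eq {a b q r : ℝ} (hq : q ≠ 0) (hr : r ≠ 0) (hab : a = 0 ↔ b = 0) :
    (a * q - b * r) * Real.log ((a * q) / (b * r)) =
      q * (a * -Real.log b - Real.negMulLog a) + r * (b * -Real.log a - Real.negMulLog b) +
      Real.log (q / r) * (q * a - r * b) := by
  by_cases ha : a = 0
  · have hb := hab.mp ha
    simp [ha, hb]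
  · have hb : b ≠ 0 := fun h => ha (hab.mpr h)
    rw [Real.log_div (mul_ne_zero ha hq) (mul_ne_zero hb hr), Real.log_mul ha hq,
      Real.log_mul hb hr, Real.log_div hq hr, Real.negMulLog, Real.negMulLog]
    ring

/-- The sum of the pair contributions reduces to the cross terms and to the flux of
`log (Q i j / Q j i)`. -/
theorem sum_pair_contributions [Fintype V] {Q : Matrix V V ℝ} (hQ : IsRateMatrix Q)
    (L : V → V → ℝ) (H P : V → ℝ) :
    (1 / 2) * ∑ z : V × V, (Q z.1 z.2 * (L z.1 z.2 - H z.1) + Q z.2 z.1 * (L z.2 z.1 - H z.2) +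
      Real.log (Q z.1 z.2 / Q z.2 z.1) * (Q z.1 z.2 * P z.1 - Q z.2 z.1 * P z.2)) =
    ∑ j, ∑ i, Q i j * L i j + ∑ i, (∑ j, Q i j * Real.log (Q i j / Q j i)) * P i := by
  -- Zero row sums, diagonal included, cancel the own-entropy terms `H`.
  have h1 : ∑ i, ∑ j, Q i j * (L i j - H i) = ∑ j, ∑ i, Q i j * L i j := by
    rw [Finset.sum_comm (f := fun j i => Q i j * L i j)]
    refine Finset.sum_congr rfl fun i _ => ?_
    simp_rw [mul_sub, Finset.sum_sub_distrib, ← Finset.sum_mul, hQ.row_sum]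
    ring
  have h2 : ∑ i, ∑ j, Q j i * (L j i - H j) = ∑ j, ∑ i, Q i j * L i j := by
    rw [← h1, Finset.sum_comm]
  have h3 : ∑ i, ∑ j, Real.log (Q i j / Q j i) * (Q i j * P i) =
      ∑ i, (∑ j, Q i j * Real.log (Q i j / Q j i)) * P i := by
    refine Finset.sum_congr rfl fun i _ => ?_
    rw [Finset.sum_mul]
    exact Finset.sum_congr rfl fun j _ => by ring
  have h4 : ∑ i, ∑ j, Real.log (Q i j / Q j i) * (Q j i * P j) =
      -∑ i, (∑ j, Q i j * Real.log (Q i j / Q j i)) * P i := by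
    rw [← h3, Finset.sum_comm, ← Finset.sum_neg_distrib]
    refine Finset.sum_congr rfl fun i _ => ?_
    rw [← Finset.sum_neg_distrib]
    refine Finset.sum_congr rfl fun j _ => ?_
    rw [← inv_div, Real.log_inv]
    ring
  rw [Fintype.sum_prod_type]
  simp only [mul_sub (Real.log _), Finset.sum_add_distrib, Finset.sum_sub_distrib]
  rw [h1, h2, h3, h4]
  ring

variable [Fintype V] [AddCommGroup A] {Q : Matrix V V ℝ} {w : V → V → A} {p : ℝ → V × A → ℝ}

/-- By antisymmetry of `w` both rates between two states vanish unless the second is the endpoint of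
a jump from the first, so the pairs that matter are indexed by `(i, j, α)`. -/
theorem hasSum_entropyProductionTerm_of_pairs [DecidableEq A] (hw : ∀ i j, w j i = -w i j)
    {u : V × A → ℝ} {a : V × V → ℝ}
    (h : ∀ i j, HasSum (fun α => (u (i, α) * Q i j - u (j, α + w i j) * Q j i) *
      Real.log ((u (i, α) * Q i j) / (u (j, α + w i j) * Q j i))) (a (i, j))) :
    HasSum (entropyProductionTerm (latticeRate Q w) u) (∑ z, a z) := by
  have hinj : Function.Injective
      (fun z : (V × V) × A => ((z.1.1, z.2), (z.1.2, z.2 + w z.1.1 z.1.2))) := by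
    rintro ⟨⟨i, j⟩, α⟩ ⟨⟨i', j'⟩, α'⟩ hz
    simp only [Prod.mk.injEq] at hz
    obtain ⟨⟨rfl, rfl⟩, rfl, -⟩ := hz
    rfl
  rw [← hinj.hasSum_iff]
  · refine hasSum_prod_of_fintype fun z => (h z.1 z.2).congr_terms fun α => ?_
    have : α = α + w z.1 z.2 + w z.2 z.1 := by rw [hw z.1 z.2]; abel
    simp only [entropyProductionTerm, Function.comp_apply, latticeRate, ← this, if_true]
  · rintro ⟨⟨i, α⟩, ⟨j, β⟩⟩ hz
    have h1 : ¬ β = α + w i j := by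
      rintro rfl
      exact hz ⟨((i, j), α), rfl⟩
    have h2 : ¬ α = β + w j i := by
      intro h2
      apply h1
      rw [h2, hw i j]
      abel
    simp [entropyProductionTerm, latticeRate, h1, h2]

/-- Each pair splits by `flux_mul_log_eq` into series that converge separately; shifts by `w i j`
align the reverse jumps. Positivity spreads both ways along an edge, so the two fluxes vanish
together. -/
theorem IsLiftLaw.hasSum_entropyProductionTerm [DecidableEq A] (hp : IsLiftLaw Q w p)
    (hQ : IsRateMatrix Q) (hsymm : ∀ i j, 0 < Q i j ↔ 0 < Q j i)
    (hw : ∀ i j, w j i = -w i j) (hw0 : ∀ i, w i i = 0) {t : ℝ} (ht : 0 < t)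
    (hH : Summable (fun x => Real.negMulLog (p t x)))
    (hs : ∀ i j, Q i j ≠ 0 → Summable (fun α => p t (i, α) * -Real.log (p t (j, α + w i j)))) :
    HasSum (entropyProductionTerm (latticeRate Q w) (p t))
      (∑ z : V × V, (Q z.1 z.2 * (crossEntropy w (p t) z.1 z.2 -
          ∑' α, Real.negMulLog (p t (z.1, α))) +
        Q z.2 z.1 * (crossEntropy w (p t) z.2 z.1 - ∑' α, Real.negMulLog (p t (z.2, α))) +
        Real.log (Q z.1 z.2 / Q z.2 z.1) * (Q z.1 z.2 * (∑' α, p t (z.1, α)) -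
          Q z.2 z.1 * ∑' α, p t (z.2, α)))) := by
  refine hasSum_entropyProductionTerm_of_pairs hw (a := fun z => _) fun i j => ?_
  by_cases hij : Q i j = 0
  · have hji := (hQ.eq_zero_comm hsymm i j).mp hij
    simp [hij, hji, hasSum_zero]
  have hji : Q j i ≠ 0 := fun h => hij ((hQ.eq_zero_comm hsymm i j).mpr h)
  have hback : ∀ α, α + w i j + w j i = α := fun α => by rw [hw i j]; abel
  have hshift : ∀ {f : A → ℝ}, Summable f → HasSum (fun α => f (α + w i j)) (∑' α, f α) :=
    fun hf => (Equiv.addRight (w i j)).hasSum_iff.mpr hf.hasSum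
  have h1 := ((hs i j hij).hasSum.sub (hH.slice i).hasSum).mul_left (Q i j)
  have h2 := ((hshift (hs j i hji)).sub (hshift (hH.slice j))).mul_left (Q j i)
  have h3 := (((hp.summable_slice ht.le i).hasSum.mul_left (Q i j)).sub
    ((hshift (hp.summable_slice ht.le j)).mul_left (Q j i))).mul_left (Real.log (Q i j / Q j i))
  refine ((h1.add h2).add h3).congr_terms fun α => ?_
  simp only [hback]
  refine (flux_mul_log_eq hij hji ⟨fun h => ?_, fun h => ?_⟩).symm
  · by_contra hne
    have := hp.ne_zero_of_rate_ne_zero hQ hw0 ht hji hne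
    rw [hback] at this
    exact this h
  · by_contra hne
    exact hp.ne_zero_of_rate_ne_zero hQ hw0 ht hij hne h

theorem IsLiftLaw.intervalIntegrable_marginal [Countable A] (hp : IsLiftLaw Q w p) (i : V)
    {T : ℝ} (hT : 0 ≤ T) : IntervalIntegrable (fun t => ∑' α, p t (i, α)) volume 0 T := by
  rw [intervalIntegrable_iff_integrableOn_Ioc_of_le hT]
  refine (hasSum_integral_of_sum_norm_le (F := fun α t => p t (i, α)) (g := fun _ => 1)
    (fun α => hp.aestronglyMeasurable T _) (integrable_const _) ?_).1
  filter_upwards [ae_restrict_mem measurableSet_Ioc] with t ht s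
  refine le_trans (le_of_eq ?_) (((hp.summable_slice ht.1.le i).sum_le_tsum s
    (fun α _ => hp.nonneg t ht.1.le _)).trans (hp.marginal_le_one ht.1.le i))
  exact Finset.sum_congr rfl fun α _ => Real.norm_of_nonneg (hp.nonneg t ht.1.le _)

/-- The entropy balance: the produced entropy is the gain of entropy plus the entropy flux. -/
theorem IsLiftLaw.entropy_balance [Countable A] [DecidableEq A] (hp : IsLiftLaw Q w p)
    (hQ : IsRateMatrix Q) (hsymm : ∀ i j, 0 < Q i j ↔ 0 < Q j i)
    (hw : ∀ i j, w j i = -w i j) (hw0 : ∀ i, w i i = 0) {T b : ℝ} (hT : 0 ≤ T)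
    (hs : ∀ t, 0 ≤ t → Summable (fun x => Real.negMulLog (p t x)))
    (hb : ∀ t ∈ Set.Ioc 0 T, ∑' x, Real.negMulLog (p t x) ≤ b) :
    IntervalIntegrable (fun t => entropyProductionRate (latticeRate Q w) (p t)) volume 0 T ∧
    ∫ t in (0 : ℝ)..T, entropyProductionRate (latticeRate Q w) (p t) =
      ∑' x, Real.negMulLog (p T x) - ∑' x, Real.negMulLog (p 0 x) +
      ∑ i, (∑ j, Q i j * Real.log (Q i j / Q j i)) * ∫ t in (0 : ℝ)..T, ∑' α, p t (i, α) := by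
  obtain ⟨c, hc⟩ := hp.crossEntropy_bound hQ hw0
  obtain ⟨hint, heq⟩ := hp.integral_entropy_deriv hQ hw0 hT hs hb
  have hflux : ∀ i, IntervalIntegrable (fun t => (∑ j, Q i j * Real.log (Q i j / Q j i)) *
      ∑' α, p t (i, α)) volume 0 T := fun i => (hp.intervalIntegrable_marginal i hT).const_mul _
  have hflux' : IntervalIntegrable (fun t => ∑ i, (∑ j, Q i j * Real.log (Q i j / Q j i)) *
      ∑' α, p t (i, α)) volume 0 T :=
    (intervalIntegrable_iff_integrableOn_Ioc_of_le hT).mpr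
      (integrable_finsetSum _ fun i _ =>
        (intervalIntegrable_iff_integrableOn_Ioc_of_le hT).mp (hflux i))
  have hpt : ∀ t, 0 < t → entropyProductionRate (latticeRate Q w) (p t) =
      ∑ j, ∑ i, Q i j * crossEntropy w (p t) i j +
      ∑ i, (∑ j, Q i j * Real.log (Q i j / Q j i)) * ∑' α, p t (i, α) := by
    intro t ht
    rw [entropyProductionRate, (hp.hasSum_entropyProductionTerm hQ hsymm hw hw0 ht (hs t ht.le)
      (fun i j hij => (hc t ht (hs t ht.le) i j hij).1)).tsum_eq]
    exact sum_pair_contributions hQ (crossEntropy w (p t))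
      (fun i => ∑' α, Real.negMulLog (p t (i, α))) (fun i => ∑' α, p t (i, α))
  have hae : ∀ᵐ t ∂volume, t ∈ Set.uIoc 0 T →
      ∑ j, ∑ i, Q i j * crossEntropy w (p t) i j +
      ∑ i, (∑ j, Q i j * Real.log (Q i j / Q j i)) * ∑' α, p t (i, α) =
      entropyProductionRate (latticeRate Q w) (p t) := by
    refine Eventually.of_forall fun t ht => ?_
    rw [Set.uIoc_of_le hT] at ht
    exact (hpt t ht.1).symm
  constructor
  · exact (hint.add hflux').congr_ae
      ((ae_restrict_iff' measurableSet_uIoc).mpr hae)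
  · rw [← intervalIntegral.integral_congr_ae hae, intervalIntegral.integral_add hint hflux', heq,
      intervalIntegral.integral_finsetSum fun i _ => hflux i]
    simp only [intervalIntegral.integral_const_mul]

end EntropyProduction

/-! ### Stationary distribution of the finite chain -/

section FiniteChain

variable {V : Type*} [Fintype V] {Q : Matrix V V ℝ} {π : V → ℝ}

/-- A zero of `π` propagates backwards along transitions, hence by irreducibility to all states,
against total mass one. -/
theorem IsStationaryDistribution.pos (hπ : IsStationaryDistribution Q π) (hQ : IsRateMatrix Q)
    (hirr : IsIrreducibleChain Q) (j : V) : 0 < π j := by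
  refine lt_of_le_of_ne (hπ.nonneg j) fun h0 => ?_
  have hstep : ∀ a b, 0 < Q a b → π b = 0 → π a = 0 := by
    intro a b hab hb
    have hnn : ∀ i ∈ Finset.univ, 0 ≤ π i * Q i b := by
      intro i _
      by_cases hib : i = b
      · rw [hib, hb, zero_mul]
      · exact mul_nonneg (hπ.nonneg i) (hQ.nonneg i b hib)
    have := (Finset.sum_eq_zero_iff_of_nonneg hnn).mp (hπ.balance b) a (Finset.mem_univ a)
    exact (mul_eq_zero.mp this).resolve_right hab.ne'
  have hall : ∀ i, π i = 0 := fun i =>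
    Relation.ReflTransGen.head_induction_on (motive := fun a _ => π a = 0) (hirr i j) h0.symm
      (fun hab _ hb => hstep _ _ hab hb)
  have := hπ.sum_one
  simp [hall] at this

/-- Uniqueness of the stationary vector of an irreducible chain, up to normalization. -/
theorem IsStationaryDistribution.eq_zero_of_balance (hπ : IsStationaryDistribution Q π)
    (hQ : IsRateMatrix Q) (hirr : IsIrreducibleChain Q) {v : V → ℝ}
    (hv : ∀ j, ∑ i, v i * Q i j = 0) (hv0 : ∑ i, v i = 0) : v = 0 := by
  have hpos := hπ.pos hQ hirr
  have hne : Nonempty V := by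
    by_contra hemp
    rw [not_nonempty_iff] at hemp
    simpa using hπ.sum_one
  -- Maximum principle: `M * π - v` is non-negative and balanced, so its zero at a maximizer of `v /
  -- π` spreads to all predecessors.
  obtain ⟨m, hm⟩ := Finite.exists_max (fun i => v i / π i)
  set M := v m / π m with hM
  have hvM : ∀ i, v i / π i = M → v i = M * π i := fun i h => by
    rw [← h, div_mul_cancel₀ _ (hpos i).ne']
  have hstep : ∀ a b, 0 < Q a b → v b / π b = M → v a / π a = M := by
    intro a b hab hb
    have hle : ∀ i, 0 ≤ M * π i - v i := fun i => by
      have := hm i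
      rw [div_le_iff₀ (hpos i)] at this
      linarith
    have hnn : ∀ i ∈ Finset.univ, 0 ≤ (M * π i - v i) * Q i b := by
      intro i _
      by_cases hib : i = b
      · rw [hib, ← hvM b hb, sub_self, zero_mul]
      · exact mul_nonneg (hle i) (hQ.nonneg i b hib)
    have hsum : ∑ i, (M * π i - v i) * Q i b = 0 := by
      simp_rw [sub_mul, mul_assoc, Finset.sum_sub_distrib, ← Finset.mul_sum, hπ.balance, hv]
      ring
    have h1 := (Finset.sum_eq_zero_iff_of_nonneg hnn).mp hsum a (Finset.mem_univ a)
    have h2 := (mul_eq_zero.mp h1).resolve_right hab.ne'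
    rw [div_eq_iff (hpos a).ne']
    linarith
  have hall : ∀ i, v i = M * π i := fun i => hvM i
    (Relation.ReflTransGen.head_induction_on (motive := fun a _ => v a / π a = M) (hirr i m) hM.symm
      (fun hab _ hb => hstep _ _ hab hb))
  simp_rw [hall, ← Finset.mul_sum, hπ.sum_one, mul_one] at hv0
  funext i
  rw [hall, hv0, zero_mul, Pi.zero_apply]

/-- A family of asymptotically stationary vectors of mass one converges to the stationary
distribution. -/
theorem IsStationaryDistribution.tendsto_of_balance (hπ : IsStationaryDistribution Q π)
    (hQ : IsRateMatrix Q) (hirr : IsIrreducibleChain Q) {l : Filter ℝ} {m : ℝ → V → ℝ}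
    (hm : ∀ j, Tendsto (fun T => ∑ i, m T i * Q i j) l (𝓝 0))
    (hm1 : Tendsto (fun T => ∑ i, m T i) l (𝓝 1)) : Tendsto m l (𝓝 π) := by
  -- Balance and mass together form an injective linear map in finite dimension, hence an
  -- antilipschitz one; convergence of the images lifts to convergence of the vectors.
  let Φ : (V → ℝ) →ₗ[ℝ] (V → ℝ) × ℝ := (Matrix.vecMulLinear Q).prod (∑ i, LinearMap.proj i)
  have hΦ : ∀ v, Φ v = (fun j => ∑ i, v i * Q i j, ∑ i, v i) := by
    intro v
    ext j
    · simp [Φ, Matrix.vecMul, dotProduct]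
    · simp [Φ]
  have hker : LinearMap.ker Φ = ⊥ := by
    rw [LinearMap.ker_eq_bot']
    intro v hv
    rw [hΦ, Prod.mk_eq_zero] at hv
    exact hπ.eq_zero_of_balance hQ hirr (fun j => congrFun hv.1 j) hv.2
  obtain ⟨K, -, hK⟩ := LinearMap.exists_antilipschitzWith Φ hker
  have hlim : Tendsto (fun T => Φ (m T)) l (𝓝 (Φ π)) := by
    have h : Φ π = (0, 1) := by
      rw [hΦ, hπ.sum_one]
      congr 1
      exact funext hπ.balance
    rw [h]
    simp_rw [hΦ]
    exact (tendsto_pi_nhds.mpr hm).prodMk_nhds hm1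
  rw [tendsto_iff_dist_tendsto_zero] at hlim ⊢
  refine squeeze_zero (fun T => dist_nonneg) (fun T => hK.le_mul_dist _ _) ?_
  simpa using hlim.const_mul (K : ℝ)

/-- The stationary entropy production rate is the stationary entropy flux. -/
theorem IsStationaryDistribution.entropyProductionRate_eq (hπ : IsStationaryDistribution Q π)
    (hQ : IsRateMatrix Q) (hirr : IsIrreducibleChain Q)
    (hsymm : ∀ i j, 0 < Q i j ↔ 0 < Q j i) :
    entropyProductionRate Q π = ∑ i, (∑ j, Q i j * Real.log (Q i j / Q j i)) * π i := by
  have hpos := hπ.pos hQ hirr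
  have h := sum_pair_contributions hQ (fun i j => π i * -Real.log (π j))
    (fun i => Real.negMulLog (π i)) π
  -- At stationarity the entropy gain vanishes by balance.
  have h0 : ∑ j, ∑ i, Q i j * (π i * -Real.log (π j)) = 0 := by
    refine Finset.sum_eq_zero fun j _ => ?_
    have := congrArg (· * -Real.log (π j)) (hπ.balance j)
    simp only [Finset.sum_mul, zero_mul] at this
    rw [← this]
    exact Finset.sum_congr rfl fun i _ => by ring
  rw [h0, zero_add] at h
  rw [← h]
  unfold entropyProductionRate
  rw [tsum_fintype]
  congr 1
  refine Finset.sum_congr rfl fun z _ => ?_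
  unfold entropyProductionTerm
  by_cases hz : Q z.1 z.2 = 0
  · have hz' := (hQ.eq_zero_comm hsymm z.1 z.2).mp hz
    simp [hz, hz']
  · have hz' : Q z.2 z.1 ≠ 0 := fun h => hz ((hQ.eq_zero_comm hsymm z.1 z.2).mpr h)
    exact flux_mul_log_eq hz hz' (by simp [(hpos _).ne'])

end FiniteChain

/-! ### Long-time limits -/

section LongTime

/-- A nonnegative function with arbitrarily small linear growth is sublinear. -/
theorem tendsto_div_atTop_of_linear_growth {H : ℝ → ℝ} {C : ℝ} (hC : 0 ≤ C)
    (hH0 : ∀ T, 0 ≤ T → 0 ≤ H T)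
    (hH : ∀ δ > 0, ∃ Z, ∀ T, 0 ≤ T → H T ≤ C * δ * T + Z) :
    Tendsto (fun T => (1 / T) * H T) atTop (𝓝 0) := by
  rw [Metric.tendsto_atTop]
  intro η hη
  -- Keeps the slope `C * δ` at most `η / 2`, also when `C = 0`; for large `T` the constant `Z` uses
  -- the other half.
  obtain ⟨Z, hZ⟩ := hH (η / (2 * (C + 1))) (by positivity)
  refine ⟨max 1 (2 * Z / η + 1), fun T hT => ?_⟩
  have hT1 : 0 < T := lt_of_lt_of_le one_pos ((le_max_left _ _).trans hT)
  have hT2 : 2 * Z / η < T := by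
    have := (le_max_right 1 (2 * Z / η + 1)).trans hT
    linarith
  rw [div_lt_iff₀ hη] at hT2
  have h1 := hZ T hT1.le
  have h2 : C * (η / (2 * (C + 1))) ≤ η / 2 := by
    rw [mul_div_assoc', div_le_div_iff₀ (by positivity) two_pos]
    nlinarith
  have h3 : H T < η * T := by nlinarith
  rw [Real.dist_eq, sub_zero, abs_of_nonneg (mul_nonneg (by positivity) (hH0 T hT1.le)),
    one_div_mul_eq_div, div_lt_iff₀ hT1]
  exact h3

variable {V A : Type*} [Fintype V] [AddCommGroup A] [Countable A]
  {Q : Matrix V V ℝ} {w : V → V → A} {p : ℝ → V × A → ℝ}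

/-- Testing with the indicator of the fibre over `j` gives the integrated master equation of `M` for
the marginals. -/
theorem IsLiftLaw.integral_marginal_balance (hp : IsLiftLaw Q w p) (j : V) {T : ℝ} (hT : 0 ≤ T) :
    ∑ i, (∫ t in (0 : ℝ)..T, ∑' α, p t (i, α)) * Q i j =
      ∑' α, p T (j, α) - ∑' α, p 0 (j, α) := by
  classical
  have hf : ∀ x : V × A, |(if x.1 = j then (1 : ℝ) else 0)| ≤ 1 := by
    intro x
    split_ifs <;> simp
  have h := (hp.integral_test hf hT).2
  have hm : ∀ t, 0 ≤ t → ∑' x : V × A, p t x * (if x.1 = j then (1 : ℝ) else 0) =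
      ∑' α, p t (j, α) := by
    intro t ht
    have h1 : ∀ i, HasSum (fun α => p t (i, α) * (if i = j then (1 : ℝ) else 0))
        ((∑' α, p t (i, α)) * (if i = j then (1 : ℝ) else 0)) := fun i =>
      (hp.summable_slice ht i).hasSum.mul_right _
    rw [(hasSum_prod_of_fintype (f := fun x : V × A => p t x * (if x.1 = j then (1 : ℝ) else 0))
      h1).tsum_eq]
    simp
  rw [hm T hT, hm 0 le_rfl] at h
  rw [← h]
  have h2 : ∀ t, ∑ j', ∑ i, Q i j' * ∑' α, p t (i, α) * (if j' = j then (1 : ℝ) else 0) =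
      ∑ i, (∑' α, p t (i, α)) * Q i j := by
    intro t
    simp_rw [tsum_mul_right]
    rw [Finset.sum_comm]
    refine Finset.sum_congr rfl fun i _ => ?_
    simp [mul_comm]
  simp_rw [h2]
  rw [intervalIntegral.integral_finsetSum fun i _ =>
    (hp.intervalIntegrable_marginal i hT).mul_const _]
  simp only [intervalIntegral.integral_mul_const]

/-- The time averages of the marginals on `V` converge to the stationary distribution. -/
theorem IsLiftLaw.tendsto_average_marginal (hp : IsLiftLaw Q w p) (hQ : IsRateMatrix Q)
    (hirr : IsIrreducibleChain Q) {π : V → ℝ} (hπ : IsStationaryDistribution Q π) (i : V) :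
    Tendsto (fun T : ℝ => (1 / T) * ∫ t in (0 : ℝ)..T, ∑' α, p t (i, α)) atTop (𝓝 (π i)) := by
  have hinv : Tendsto (fun T : ℝ => 1 / T) atTop (𝓝 0) := by
    simpa using tendsto_inv_atTop_zero (𝕜 := ℝ)
  refine tendsto_pi_nhds.mp (hπ.tendsto_of_balance hQ hirr
    (m := fun T i => (1 / T) * ∫ t in (0 : ℝ)..T, ∑' α, p t (i, α)) (fun j => ?_) ?_) i
  · refine squeeze_zero_norm' ?_ hinv
    filter_upwards [eventually_gt_atTop 0] with T hT
    simp_rw [mul_assoc]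
    rw [← Finset.mul_sum, hp.integral_marginal_balance j hT.le, norm_mul,
      Real.norm_of_nonneg (by positivity : 0 ≤ 1 / T), Real.norm_eq_abs]
    refine mul_le_of_le_one_right (by positivity) ?_
    rw [abs_le]
    have h1 := hp.marginal_nonneg hT.le j
    have h2 := hp.marginal_le_one hT.le j
    have h3 := hp.marginal_nonneg le_rfl j
    have h4 := hp.marginal_le_one le_rfl j
    constructor <;> linarith
  · refine tendsto_const_nhds.congr' ?_
    filter_upwards [eventually_gt_atTop 0] with T hT
    rw [← Finset.mul_sum, ← intervalIntegral.integral_finsetSum fun i _ =>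
      hp.intervalIntegrable_marginal i hT.le]
    have : ∫ t in (0 : ℝ)..T, ∑ i, ∑' α, p t (i, α) = ∫ t in (0 : ℝ)..T, (1 : ℝ) := by
      refine intervalIntegral.integral_congr fun t ht => ?_
      rw [Set.uIcc_of_le hT.le] at ht
      exact hp.sum_marginal ht.1
    rw [this]
    simp [hT.ne']

end LongTime

/-! ### The main theorem -/

theorem mainTheorem1 {V : Type*} [Fintype V] [DecidableEq V]
    (Q : Matrix V V ℝ) (hQ : IsRateMatrix Q) (hirr : IsIrreducibleChain Q)
    (hsymm : ∀ i j, 0 < Q i j ↔ 0 < Q j i)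
    (π : V → ℝ) (hπ : IsStationaryDistribution Q π)
    (n : ℕ) (e : TorusEmbedding Q n)
    (p : ℝ → V × (Fin n → ℤ) → ℝ) (hp : IsChainLaw e.liftRate p)
    (hH : HasFiniteEntropy (p 0)) :
    (∀ t, 0 < t → Summable (entropyProductionTerm e.liftRate (p t))) ∧
    (∀ T, 0 ≤ T →
      IntervalIntegrable (fun t => entropyProductionRate e.liftRate (p t)) volume 0 T) ∧
    Tendsto (fun T : ℝ => (1 / T) * ∫ t in (0 : ℝ)..T, entropyProductionRate e.liftRate (p t))
      atTop (𝓝 (entropyProductionRate Q π)) := by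
  have hL : IsLiftLaw Q e.crossing p := hp.isLiftLaw
  have hrate : e.liftRate = latticeRate Q e.crossing := rfl
  have hw := e.crossing_swap
  have hw0 : ∀ i, e.crossing i i = 0 := fun i => self_eq_neg.mp (hw i i)
  -- `Z` depends on `δ` but not on `T`: `δ → 0` gives sublinear entropy, while `δ = 1` already gives
  -- finiteness and local boundedness.
  have hgrowth : ∀ δ > 0, ∃ Z, ∀ T, 0 ≤ T →
      Summable (fun x => Real.negMulLog (p T x)) ∧
      ∑' x, Real.negMulLog (p T x) ≤ (∑ j, ∑ i, |Q i j|) * δ * T + Z := by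
    intro δ hδ
    obtain ⟨q, hq, hq1, hq0, hqs, hqw⟩ := exists_lattice_weight e.crossing hδ
    refine ⟨∑' x, Real.negMulLog (p 0 x) + Fintype.card V * ∑' α, q α, fun T hT => ?_⟩
    obtain ⟨h1, h2⟩ := hL.entropy_le hQ hq hq1 hq0 hqs hqw hH hT
    exact ⟨h1, by linarith⟩
  have hC : 0 ≤ ∑ j, ∑ i, |Q i j| := by positivity
  have hs : ∀ t, 0 ≤ t → Summable (fun x => Real.negMulLog (p t x)) := by
    obtain ⟨Z, hZ⟩ := hgrowth 1 one_pos
    exact fun t ht => (hZ t ht).1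
  have hbdd : ∀ T, ∃ b, ∀ t ∈ Set.Ioc 0 T, ∑' x, Real.negMulLog (p t x) ≤ b := by
    intro T
    obtain ⟨Z, hZ⟩ := hgrowth 1 one_pos
    refine ⟨(∑ j, ∑ i, |Q i j|) * 1 * T + Z, fun t ht => (hZ t ht.1.le).2.trans ?_⟩
    have := mul_le_mul_of_nonneg_left ht.2 hC
    linarith
  choose b hb using hbdd
  have hbal := fun T (hT : 0 ≤ T) => hL.entropy_balance hQ hsymm hw hw0 hT hs (hb T)
  rw [hrate]
  refine ⟨fun t ht => ?_, fun T hT => (hbal T hT).1, ?_⟩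
  · obtain ⟨c, hc⟩ := hL.crossEntropy_bound hQ hw0
    exact (hL.hasSum_entropyProductionTerm hQ hsymm hw hw0 ht (hs t ht.le)
      (fun i j hij => (hc t ht (hs t ht.le) i j hij).1)).summable
  · have h1 : Tendsto (fun T : ℝ => (1 / T) * ∑' x, Real.negMulLog (p T x)) atTop (𝓝 0) :=
      tendsto_div_atTop_of_linear_growth hC
        (fun T hT => tsum_nonneg fun x =>
          Real.negMulLog_nonneg (hL.nonneg T hT x) (hL.le_one hT x))
        (fun δ hδ => by
          obtain ⟨Z, hZ⟩ := hgrowth δ hδ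
          exact ⟨Z, fun T hT => (hZ T hT).2⟩)
    have h2 : Tendsto (fun T : ℝ => (1 / T) * ∑' x, Real.negMulLog (p 0 x)) atTop (𝓝 0) := by
      simpa using (tendsto_inv_atTop_zero (𝕜 := ℝ)).mul_const (∑' x, Real.negMulLog (p 0 x))
    have h3 : Tendsto (fun T : ℝ => ∑ i, (∑ j, Q i j * Real.log (Q i j / Q j i)) *
        ((1 / T) * ∫ t in (0 : ℝ)..T, ∑' α, p t (i, α))) atTop
        (𝓝 (∑ i, (∑ j, Q i j * Real.log (Q i j / Q j i)) * π i)) :=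
      tendsto_finsetSum _ fun i _ => (hL.tendsto_average_marginal hQ hirr hπ i).const_mul _
    rw [hπ.entropyProductionRate_eq hQ hirr hsymm]
    have h4 := (h1.sub h2).add h3
    rw [sub_zero, zero_add] at h4
    refine h4.congr' ?_
    filter_upwards [eventually_ge_atTop 0] with T hT
    rw [(hbal T hT).2, mul_add, mul_sub, Finset.mul_sum]
    congr 1
    exact Finset.sum_congr rfl fun i _ => by ring
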